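/- Let $\mathcal G$ be the radial graph of $\mathbb Z^2$: its vertices are the points of $\mathbb Z^2$ and of $\mathbb Z^2+(\tfrac12,\tfrac12)$; two points of $\mathbb Z^2$ at distance $1$ are adjacent, and a point of $\mathbb Z^2$ is adjacent to a point of $\mathbb Z^2+(\tfrac12,\tfrac12)$ at distance $\tfrac{\sqrt2}{2}$ from it; there are no other edges. For integers $m,n\ge 0$ with $m+n$ odd let $G=G^{(m,n)}$ be the subgraph of $\mathcal G$ induced by the vertices in $[0,m]\times[0,n]$, and let $k=\frac{m+n+1}{2}$. Let $V_1$ (resp. $V_2$) be the set of the vertices $(x,y)\in\mathbb Z^2$ of $G$ with $x-y$ even (resp. odd), let $V_3$ be the set of the vertices of $G$ in $\mathbb Z^2+(\tfrac12,\tfrac12)$, and let $E_2$ be the set of the edges of $G$ with both endpoints in $V_1\cup V_2$. For $j=1,2$ let $G_j$ be the graph on $V_j$ in which two distinct vertices $x,y$ are adjacent iff there is a $z\in V_3$ (a middle vertex of the edge $xy$) that is adjacent in $G$ to both $x$ and $y$. A dimer covering of $G$ is a set $M$ of edges of $G$ such that each vertex of $G$ lies on exactly one edge of $M$. Let $\mathcal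 D(G)$ be the set of dimer coverings of $G$, and let $\mathcal F(G,P)$ be the set of triples $(F_1,F_2,\{e_j\}_{j=1}^k)$ in which $F_j$ is a spanning forest of $G_j$ with exactly $k$ components (single vertices are allowed as components) for $j=1,2$, and $\{e_j\}_{j=1}^k\subset E_2$ is a set of $k$ edges (impurities), such that (P)(1) no vertex of $V_3$ is a middle vertex both of an edge of $F_1$ and of an edge of $F_2$; (P)(2) the impurities pair the trees of $F_1$ with the trees of $F_2$: there is a bijection $\sigma$ from the components of $F_1$ to the components of $F_2$ such that each component $T$ of $F_1$ is joined to $\sigma(T)$ by exactly one of the $e_j$, and each $e_j$ joins some $T$ to $\sigma(T)$. Then there is a bijection $\mathcal D(G)\to\mathcal F(G,P)$. More precisely, there is one that sends each $M\in\mathcal D(G)$ to the triple in which $\{e_j\}=M\cap E_2$, and in which an edge $xy$ of $G_j$ belongs to $F_j$ iff $M$ contains an edge joining a middle vertex of $xy$ to $x$ or to $y$. -/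

import Mathlib

namespace RadialGraph

/-- The vertices of the radial graph of `ℤ²`: `Sum.inl (x, y)` is the lattice point `(x, y)` and
`Sum.inr (x, y)` is the point `(x + 1/2, y + 1/2)`, the centre of the unit face whose lower left
corner is `(x, y)`. -/
abbrev Vertex : Type := (ℤ × ℤ) ⊕ (ℤ × ℤ)

/-- Adjacency in the radial graph. A lattice point is adjacent to the lattice points at distance
`1`, and to the centres of the four faces that have it as a corner, which are the centres at
distance `√2 / 2`. Two centres are never adjacent. -/
def adj : Vertex → Vertex → Prop
  | Sum.inl p, Sum.inl q => (p.1 - q.1) ^ 2 + (p.2 - q.2) ^ 2 = 1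
  | Sum.inl p, Sum.inr q => (p.1 = q.1 ∨ p.1 = q.1 + 1) ∧ (p.2 = q.2 ∨ p.2 = q.2 + 1)
  | Sum.inr q, Sum.inl p => (p.1 = q.1 ∨ p.1 = q.1 + 1) ∧ (p.2 = q.2 ∨ p.2 = q.2 + 1)
  | Sum.inr _, Sum.inr _ => False

/-- The radial graph of `ℤ²`. -/
def radialGraph : SimpleGraph Vertex where
  Adj := adj
  symm := ⟨by
    rintro (p | p) (q | q) h
    · simp only [adj] at h ⊢
      linarith [h, sub_sq_comm p.1 q.1, sub_sq_comm p.2 q.2]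
    · exact h
    · exact h
    · exact h⟩
  loopless := ⟨by
    rintro (p | p) h
    · simp [adj] at h
    · exact h⟩

/-- The vertices of the rectangle with `m` blocks in the horizontal and `n` blocks in the vertical
direction: the lattice points of `[0, m] × [0, n]` and the centres of its `m * n` unit faces. -/
def rectSet (m n : ℕ) : Set Vertex :=
  {v | match v with
    | Sum.inl p => (0 ≤ p.1 ∧ p.1 ≤ m) ∧ (0 ≤ p.2 ∧ p.2 ≤ n)
    | Sum.inr q => (0 ≤ q.1 ∧ q.1 < m) ∧ (0 ≤ q.2 ∧ q.2 < n)}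

/-- The rectangle `G^{(m,n)}`, as an induced subgraph of the radial graph. -/
def rect (m n : ℕ) : SimpleGraph (rectSet m n) := radialGraph.induce (rectSet m n)

/-- The vertices of the rectangle that are lattice points with even coordinate difference. -/
def V₁ (m n : ℕ) : Set (rectSet m n) := {v | ∃ x y : ℤ, v.1 = Sum.inl (x, y) ∧ Even (x - y)}

/-- The vertices of the rectangle that are lattice points with odd coordinate difference. -/
def V₂ (m n : ℕ) : Set (rectSet m n) := {v | ∃ x y : ℤ, v.1 = Sum.inl (x, y) ∧ Odd (x - y)}

/-- The vertices of the rectangle that are centres of unit faces. -/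
def V₃ (m n : ℕ) : Set (rectSet m n) := {v | ∃ x y : ℤ, v.1 = Sum.inr (x, y)}

/-- The edges of the rectangle between lattice points. -/
def E₂ (m n : ℕ) : Set (Sym2 (rectSet m n)) :=
  {e | e ∈ (rect m n).edgeSet ∧ ∀ v ∈ e, v ∈ V₁ m n ∪ V₂ m n}

/-- A dimer covering of a graph: a set of edges such that every vertex lies on exactly one of
them. -/
def DimerCovering {V : Type*} (G : SimpleGraph V) : Type _ :=
  {M : Set (Sym2 V) // M ⊆ G.edgeSet ∧ ∀ x : V, ∃! e, e ∈ M ∧ x ∈ e}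

/-- `z` is a middle vertex of `x` and `y`: a face centre adjacent to both. -/
def IsMiddle {m n : ℕ} (z x y : rectSet m n) : Prop :=
  z ∈ V₃ m n ∧ (rect m n).Adj x z ∧ (rect m n).Adj z y

/-- The graph on a set `W` of vertices of the rectangle (used for `W = V₁` and `W = V₂`) in which
two distinct vertices are adjacent iff they have a middle vertex. -/
def middleGraph {m n : ℕ} (W : Set (rectSet m n)) : SimpleGraph W where
  Adj x y := x ≠ y ∧ ∃ z, IsMiddle z (x : rectSet m n) y
  symm := ⟨by
    rintro x y ⟨hne, z, hz, hxz, hzy⟩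
    exact ⟨hne.symm, z, hz, hzy.symm, hxz.symm⟩⟩
  loopless := ⟨fun _ h => h.1 rfl⟩

/-- The graph `G₁`, on the vertex class `V₁`. -/
def G₁ (m n : ℕ) : SimpleGraph (V₁ m n) := middleGraph (V₁ m n)

/-- The graph `G₂`, on the vertex class `V₂`. -/
def G₂ (m n : ℕ) : SimpleGraph (V₂ m n) := middleGraph (V₂ m n)

/-- `F` is a spanning forest of `G` with `k` components. It contains all vertices, so that an
isolated vertex of `F` is a component. -/
def IsSpanningForest {V : Type*} (G F : SimpleGraph V) (k : ℕ) : Prop :=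
  F ≤ G ∧ F.IsAcyclic ∧ Nat.card F.ConnectedComponent = k

/-- `F₁` and `F₂` do not intersect: no middle vertex is on both an edge of `F₁` and an edge of
`F₂`. -/
def NoIntersection {m n : ℕ} (F₁ : SimpleGraph (V₁ m n)) (F₂ : SimpleGraph (V₂ m n)) : Prop :=
  ∀ (x x' : V₁ m n) (y y' : V₂ m n) (z : rectSet m n),
    F₁.Adj x x' → F₂.Adj y y' → IsMiddle z (x : rectSet m n) x' →
      ¬ IsMiddle z (y : rectSet m n) y'

/-- The edge `e` joins the component `c₁` of `F₁` with the component `c₂` of `F₂`. -/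
def Joins {m n : ℕ} {F₁ : SimpleGraph (V₁ m n)} {F₂ : SimpleGraph (V₂ m n)}
    (e : Sym2 (rectSet m n)) (c₁ : F₁.ConnectedComponent) (c₂ : F₂.ConnectedComponent) : Prop :=
  ∃ (x : V₁ m n) (y : V₂ m n), e = s((x : rectSet m n), (y : rectSet m n)) ∧
    F₁.connectedComponentMk x = c₁ ∧ F₂.connectedComponentMk y = c₂

/-- The edges in `I` pair the components of `F₁` with those of `F₂`: for some one-to-one
correspondence `σ` between the components, each component `c` of `F₁` is joined with `σ c` by
exactly one edge of `I`, and every edge of `I` joins some `c` with `σ c`. -/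
def Pairs {m n : ℕ} (I : Set (Sym2 (rectSet m n)))
    (F₁ : SimpleGraph (V₁ m n)) (F₂ : SimpleGraph (V₂ m n)) : Prop :=
  ∃ σ : F₁.ConnectedComponent ≃ F₂.ConnectedComponent,
    (∀ c, ∃! e, e ∈ I ∧ Joins e c (σ c)) ∧ ∀ e ∈ I, ∃ c, Joins e c (σ c)

/-- The triples `(F₁, F₂, {e_j})` of spanning forests with `k` components and a set of `k` edges
between lattice points that satisfy condition (P). -/
structure PairedForests (m n k : ℕ) where
  /-- the forest on `G₁` -/
  F₁ : SimpleGraph (V₁ m n)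
  /-- the forest on `G₂` -/
  F₂ : SimpleGraph (V₂ m n)
  /-- the set of impurities -/
  impurities : Set (Sym2 (rectSet m n))
  forest₁ : IsSpanningForest (G₁ m n) F₁ k
  forest₂ : IsSpanningForest (G₂ m n) F₂ k
  impurities_subset : impurities ⊆ E₂ m n
  impurities_ncard : impurities.ncard = k
  noIntersection : NoIntersection F₁ F₂
  pairs : Pairs impurities F₁ F₂

/-- Two vertices `x`, `y` have a middle vertex that is matched by `M` to one of them. -/
def MatchedMiddle {m n : ℕ} (M : Set (Sym2 (rectSet m n))) (x y : rectSet m n) : Prop :=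
  ∃ z, IsMiddle z x y ∧ (s(x, z) ∈ M ∨ s(z, y) ∈ M)

end RadialGraph

/-!
Follow a lattice point `p` that is matched with a face to the opposite corner `next p` of that face.
The forests of a covering `M` are the graphs of this map on the two classes of lattice points, so
they are acyclic as soon as `next` has no cycle of length at least two. By a Jordan curve theorem
modulo 2, such a cycle encloses a nonempty set of interior points of the other class that `next` and
its inverse preserve. Every enclosed set produces another one, closer to the lower left corner and
in the other class. If it contains a cycle of `next`, take the set enclosed by this cycle. Otherwise
it contains a point that is matched with a lattice point `w`. The faces that separate the enclosed
set from its complement are matched with points of the other class, and by counting, every point of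
that class at one of these faces is matched with another of them; so the orbits that end in `w` do
not touch these faces, and those that start at a point with only enclosed neighbours form the new
one. This descent is impossible.

The fixed points of `next` are then the roots of the trees, and counting vertices gives their
number. `M` is recovered by orienting each tree towards its root, which is an endpoint of an
impurity. Conversely, the impurities together with the oriented trees of a paired forest are
pairwise disjoint edges, and there are enough of them to cover all vertices.
-/

namespace RadialGraph

/-! ### Iterates and fixed points -/

section Dynamics
variable {α : Type*} {f : α → α} {s : Set α} {x w : α}

lemma exists_iterate_mem_periodicPts (hs : s.Finite) (hf : Set.MapsTo f s s) (hx : x ∈ s) :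
    ∃ k, f^[k] x ∈ Function.periodicPts f := by
  obtain ⟨i, j, hij, h⟩ :=
    hs.exists_lt_map_eq_of_forall_mem (f := fun k => f^[k] x) fun k => hf.iterate k hx
  refine ⟨i, Function.mk_mem_periodicPts (Nat.sub_pos_of_lt hij) ?_⟩
  rw [Function.IsPeriodicPt, Function.IsFixedPt, ← Function.iterate_add_apply,
    Nat.sub_add_cancel hij.le]
  exact h.symm

lemma exists_iterate_apply_iff (hw : f w = w) : (∃ k, f^[k] (f x) = w) ↔ ∃ k, f^[k] x = w := by
  constructor
  · rintro ⟨k, hk⟩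
    exact ⟨k + 1, hk⟩
  · rintro ⟨k, hk⟩
    exact ⟨k, by rw [← Function.iterate_succ_apply, Function.iterate_succ_apply', hk, hw]⟩

lemma apply_eq_self_of_mem_periodicPts (hx : x ∈ Function.periodicPts f)
    (hfix : ∃ k, f (f^[k] x) = f^[k] x) : f x = x := by
  obtain ⟨n, hn, hper⟩ := hx
  obtain ⟨k, hk⟩ := hfix
  have hkx : f^[k] x = x :=
    calc f^[k] x = f^[n * k - k] (f^[k] x) := (Function.iterate_fixed hk _).symm
      _ = f^[n * k] x := by
        rw [← Function.iterate_add_apply, Nat.sub_add_cancel (Nat.le_mul_of_pos_left k hn)]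
      _ = x := hper.mul_const k
  rwa [hkx] at hk

end Dynamics

/-! ### Rooted forests and their parent maps -/

section RootedForests
variable {V : Type*} {G : SimpleGraph V} {f g : V → V}

lemma mem_of_reachable {s : Set V} (hs : ∀ u v, G.Adj u v → u ∈ s → v ∈ s) {u v : V}
    (h : G.Reachable u v) (hu : u ∈ s) : v ∈ s := by
  rw [SimpleGraph.reachable_iff_reflTransGen] at h
  induction h with
  | refl => exact hu
  | tail _ hadj ih => exact hs _ _ hadj ih

/-- `f` is the parent map of a rooted forest structure on `G`: it sends each vertex to its parent,
and the root of each component to itself. -/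
structure IsParentMap (G : SimpleGraph V) (f : V → V) : Prop where
  adj_iff : ∀ x y, G.Adj x y ↔ x ≠ y ∧ (f x = y ∨ f y = x)
  terminates : ∀ x, ∃ k, f (f^[k] x) = f^[k] x

namespace IsParentMap

lemma adj (h : IsParentMap G f) {x : V} (hx : f x ≠ x) : G.Adj x (f x) :=
  (h.adj_iff _ _).2 ⟨hx.symm, Or.inl rfl⟩

lemma reachable_iterate (h : IsParentMap G f) (x : V) (k : ℕ) : G.Reachable x (f^[k] x) := by
  induction k with
  | zero => exact .rfl
  | succ k ih =>
    rw [Function.iterate_succ_apply']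
    by_cases hx : f (f^[k] x) = f^[k] x
    · rwa [hx]
    · exact ih.trans (h.adj hx).reachable

lemma iterate_ne (h : IsParentMap G f) {x : V} (hx : f x ≠ x) (k : ℕ) : f^[k + 1] x ≠ x :=
  fun hk => hx <| apply_eq_self_of_mem_periodicPts
    (Function.mk_mem_periodicPts k.succ_pos hk) (h.terminates x)

lemma isAcyclic (h : IsParentMap G f) : G.IsAcyclic := by
  have isBridge_of_ne : ∀ x, f x ≠ x → G.IsBridge s(x, f x) := by
    intro x hx
    rw [SimpleGraph.isBridge_iff]
    intro hreach
    obtain ⟨k, hk⟩ : f x ∈ {u | ∃ k, f^[k] u = x} := by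
      refine mem_of_reachable (fun u v hadj hu => ?_) hreach ⟨0, rfl⟩
      rw [SimpleGraph.deleteEdges_adj, h.adj_iff] at hadj
      obtain ⟨⟨-, rfl | rfl⟩, hnot⟩ := hadj
      · obtain ⟨_ | k, hk⟩ := hu
        · obtain rfl : u = x := hk
          exact absurd rfl hnot
        · exact ⟨k, hk⟩
      · obtain ⟨k, hk⟩ := hu
        exact ⟨k + 1, hk⟩
    exact h.iterate_ne hx k hk
  rw [SimpleGraph.isAcyclic_iff_forall_adj_isBridge]
  intro v w hvw
  obtain ⟨hne, rfl | rfl⟩ := (h.adj_iff _ _).1 hvw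
  · exact isBridge_of_ne v hne.symm
  · rw [Sym2.eq_swap]
    exact isBridge_of_ne w hne

lemma eq_of_reachable (h : IsParentMap G f) {x y : V} (hx : f x = x) (hy : f y = y)
    (hxy : G.Reachable x y) : x = y := by
  obtain ⟨k, hk⟩ : y ∈ {u | ∃ k, f^[k] u = x} := by
    refine mem_of_reachable (fun u v hadj hu => ?_) hxy ⟨0, rfl⟩
    obtain ⟨-, rfl | rfl⟩ := (h.adj_iff _ _).1 hadj
    · exact (exists_iterate_apply_iff hx).2 hu
    · exact (exists_iterate_apply_iff hx).1 hu
  rw [← hk, Function.iterate_fixed hy]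

/-- The correspondence between the roots of a rooted forest and its components. -/
noncomputable def rootEquiv (h : IsParentMap G f) :
    Function.fixedPoints f ≃ G.ConnectedComponent :=
  Equiv.ofBijective (fun x => G.connectedComponentMk x) <| by
    constructor
    · rintro ⟨x, hx⟩ ⟨y, hy⟩ hxy
      exact Subtype.ext (h.eq_of_reachable hx hy (SimpleGraph.ConnectedComponent.exact hxy))
    · intro c
      induction c using SimpleGraph.ConnectedComponent.ind with
      | _ v =>
        obtain ⟨k, hk⟩ := h.terminates v
        exact ⟨⟨_, hk⟩, SimpleGraph.ConnectedComponent.sound (h.reachable_iterate v k).symm⟩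

lemma coe_rootEquiv_symm_eq (h : IsParentMap G f) {x : V} {c : G.ConnectedComponent}
    (hx : f x = x) (hc : G.connectedComponentMk x = c) : (h.rootEquiv.symm c).1 = x := by
  subst hc
  exact congrArg Subtype.val (h.rootEquiv.symm_apply_apply ⟨x, hx⟩)

lemma eq_of_fixedPoints_eq (hf : IsParentMap G f) (hg : IsParentMap G g)
    (hfix : Function.fixedPoints f = Function.fixedPoints g) : f = g := by
  have fixed_iff : ∀ x, f x = x ↔ g x = x := fun x => Set.ext_iff.1 hfix x
  -- If `f` and `g` differ at `x`, the edge from `x` to `g x` is traversed by `f` backwards.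
  have apply_ne : ∀ x, f x ≠ g x → f (g x) ≠ g (g x) := by
    intro x hx hfg
    have hgx : g x ≠ x := fun h => hx (by rw [h, fixed_iff, h])
    rcases ((hf.adj_iff _ _).1 (hg.adj hgx)).2 with h | h
    · exact hx h
    · exact hg.iterate_ne hgx 1 (hfg.symm.trans h)
  funext x
  by_contra hx
  have iterate_apply_ne : ∀ k, f (g^[k] x) ≠ g (g^[k] x) := by
    intro k
    induction k with
    | zero => exact hx
    | succ k ih =>
      rw [Function.iterate_succ_apply']
      exact apply_ne _ ih
  obtain ⟨k, hk⟩ := hg.terminates x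
  exact iterate_apply_ne k (by rw [hk, fixed_iff, hk])

end IsParentMap

lemma existsUnique_adj_dist_succ (hG : G.IsAcyclic) {x r : V} (hxr : G.Reachable x r)
    (hne : x ≠ r) : ∃! y, G.Adj x y ∧ G.dist y r + 1 = G.dist x r := by
  obtain ⟨p, hp, hpl⟩ := hxr.exists_path_of_dist
  have hnil : ¬ p.Nil := fun h => hne h.eq
  have snd_eq : ∀ y, G.Adj x y → G.dist y r + 1 = G.dist x r → p.snd = y := by
    intro y hxy hy
    obtain ⟨q, hq⟩ := (hxy.symm.reachable.trans hxr).exists_walk_length_eq_dist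
    have hpath : (q.cons hxy).IsPath :=
      SimpleGraph.Walk.isPath_of_length_eq_dist _ (by rw [SimpleGraph.Walk.length_cons, hq, hy])
    have := congrArg Subtype.val ((hG.subsingleton_path x r).elim ⟨p, hp⟩ ⟨_, hpath⟩)
    simp only at this
    rw [this, SimpleGraph.Walk.snd_cons]
  refine ⟨p.snd, ⟨p.adj_snd hnil, ?_⟩, fun y hy => (snd_eq y hy.1 hy.2).symm⟩
  have hle : G.dist p.snd r ≤ p.tail.length := SimpleGraph.dist_le _
  have htail := p.length_tail_add_one hnil
  have := (p.adj_snd hnil).diff_dist_adj (u := r)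
  rw [SimpleGraph.dist_comm (v := x), SimpleGraph.dist_comm (v := p.snd)] at this
  omega

lemma isParentMap_of_dist (hG : G.IsAcyclic) {root : V → V}
    (hreach : ∀ x, G.Reachable x (root x)) (hroot : ∀ x y, G.Adj x y → root x = root y)
    (hfix : ∀ x, x = root x → f x = x)
    (hf : ∀ x, x ≠ root x → G.Adj x (f x) ∧ G.dist (f x) (root x) + 1 = G.dist x (root x)) :
    IsParentMap G f := by
  have apply_eq : ∀ {x y}, G.Adj x y → G.dist y (root x) + 1 = G.dist x (root x) → f x = y := by
    intro x y hxy hd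
    have hx : x ≠ root x := fun h => by
      rw [← h, SimpleGraph.dist_self] at hd
      omega
    exact (existsUnique_adj_dist_succ hG (hreach x) hx).unique (hf x hx) ⟨hxy, hd⟩
  have adj_apply : ∀ x, x ≠ f x → G.Adj x (f x) := fun x hx =>
    (hf x fun h => hx (hfix x h).symm).1
  refine ⟨fun x y => ⟨fun h => ⟨h.ne, ?_⟩, ?_⟩, fun x => ?_⟩
  · rcases hG.dist_eq_dist_add_one_of_adj_of_reachable (root x) h (hreach x).symm with hd | hd <;>
      rw [SimpleGraph.dist_comm (v := x), SimpleGraph.dist_comm (v := y)] at hd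
    · exact Or.inl (apply_eq h hd.symm)
    · exact Or.inr (apply_eq h.symm (hroot x y h ▸ hd.symm))
  · rintro ⟨hne, rfl | rfl⟩
    exacts [adj_apply x hne, (adj_apply y hne.symm).symm]
  · induction hd : G.dist x (root x) using Nat.strong_induction_on generalizing x with
    | _ d ih =>
      by_cases hx : x = root x
      · exact ⟨0, hfix x hx⟩
      · obtain ⟨hadj, hlt⟩ := hf x hx
        obtain ⟨k, hk⟩ := ih _ (by rw [← hd, ← hlt, hroot _ _ hadj]; omega) (f x) rfl
        exact ⟨k + 1, hk⟩

theorem exists_isParentMap (hG : G.IsAcyclic) (ρ : G.ConnectedComponent → V)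
    (hρ : ∀ c, G.connectedComponentMk (ρ c) = c) :
    ∃ f, IsParentMap G f ∧ Function.fixedPoints f = Set.range ρ := by
  classical
  let root : V → V := fun x => ρ (G.connectedComponentMk x)
  have hreach : ∀ x, G.Reachable x (root x) := fun x =>
    SimpleGraph.ConnectedComponent.exact (hρ _).symm
  choose! parent hparent using fun x (hx : x ≠ root x) =>
    (existsUnique_adj_dist_succ hG (hreach x) hx).exists
  let f : V → V := fun x => if x = root x then x else parent x
  have f_of_ne : ∀ {x}, x ≠ root x → f x = parent x := fun h => if_neg h
  refine ⟨f, isParentMap_of_dist hG hreach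
    (fun x y h => congrArg ρ (SimpleGraph.ConnectedComponent.sound h.reachable))
    (fun x hx => if_pos hx) (fun x hx => (f_of_ne hx).symm ▸ hparent x hx), Set.ext fun x => ?_⟩
  constructor
  · intro h
    by_contra hx
    have hne : x ≠ root x := fun h => hx ⟨_, h.symm⟩
    exact (hparent x hne).1.ne' ((f_of_ne hne).symm.trans h)
  · rintro ⟨c, rfl⟩
    exact if_pos (congrArg ρ (hρ c).symm)

end RootedForests

/-! ### Corners, faces and parity classes -/

section Lattice
variable {m n : ℕ} {ε : ℤ} {p q v z : ℤ × ℤ} {R : Set (ℤ × ℤ)}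

/-- `v` is a corner of the unit face with centre `z + (1/2, 1/2)`. -/
def Corner (v z : ℤ × ℤ) : Prop := (v.1 = z.1 ∨ v.1 = z.1 + 1) ∧ (v.2 = z.2 ∨ v.2 = z.2 + 1)

/-- The corner of the face `z` opposite to the corner `p`. -/
def opp (z p : ℤ × ℤ) : ℤ × ℤ := (2 * z.1 + 1 - p.1, 2 * z.2 + 1 - p.2)

/-- The two classes of lattice points, `ε = 0` for `V₁` and `ε = 1` for `V₂`; only the parity of
`ε` matters, so that `ε + 1` always stands for the other class. -/
def InClass (ε : ℤ) (p : ℤ × ℤ) : Prop := (p.1 + p.2 + ε) % 2 = 0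

/-- Lattice points in the open rectangle. -/
def IsInterior (m n : ℕ) (p : ℤ × ℤ) : Prop := 0 < p.1 ∧ p.1 < m ∧ 0 < p.2 ∧ p.2 < n

lemma mem_rectSet_inl :
    (Sum.inl p : Vertex) ∈ rectSet m n ↔ (0 ≤ p.1 ∧ p.1 ≤ m) ∧ (0 ≤ p.2 ∧ p.2 ≤ n) := Iff.rfl

lemma mem_rectSet_inr :
    (Sum.inr z : Vertex) ∈ rectSet m n ↔ (0 ≤ z.1 ∧ z.1 < m) ∧ (0 ≤ z.2 ∧ z.2 < n) := Iff.rfl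

lemma corner_opp (h : Corner v z) : Corner (opp z v) z := by
  simp only [Corner, opp] at *
  omega

lemma inClass_opp : InClass ε (opp z v) ↔ InClass ε v := by
  simp only [InClass, opp]
  omega

lemma inClass_add_one_iff : InClass (ε + 1) p ↔ ¬ InClass ε p := by
  simp only [InClass]
  omega

lemma opp_ne (z v : ℤ × ℤ) : opp z v ≠ v := by
  intro h
  have := congrArg Prod.fst h
  simp only [opp] at this
  omega

lemma exists_corner_inClass (ε : ℤ) (z : ℤ × ℤ) : ∃ p, Corner p z ∧ InClass ε p := by
  by_cases h : InClass ε z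
  · exact ⟨z, by simp [Corner], h⟩
  · refine ⟨(z.1 + 1, z.2), by simp [Corner], ?_⟩
    simp only [InClass] at *
    omega

lemma eq_or_eq_opp (hpz : Corner p z) (hqz : Corner q z) (hp : InClass ε p) (hq : InClass ε q) :
    p = q ∨ p = opp z q := by
  simp only [Corner, InClass, opp, Prod.ext_iff] at *
  omega

lemma eq_or_of_corner (hv : InClass (ε + 1) v) (hp : InClass ε p) (hvz : Corner v z)
    (hpz : Corner p z) : p = (v.1 + 1, v.2) ∨ p = (v.1, v.2 + 1) ∨ p = (v.1 - 1, v.2) ∨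
      p = (v.1, v.2 - 1) := by
  simp only [Corner, InClass, Prod.ext_iff] at *
  omega

lemma cases_of_sq_add_sq_eq_one (h : (p.1 - q.1) ^ 2 + (p.2 - q.2) ^ 2 = 1) :
    (p.1 = q.1 ∧ (p.2 = q.2 + 1 ∨ p.2 = q.2 - 1)) ∨
      (p.2 = q.2 ∧ (p.1 = q.1 + 1 ∨ p.1 = q.1 - 1)) := by
  have hx : -1 ≤ p.1 - q.1 ∧ p.1 - q.1 ≤ 1 := by
    rw [← abs_le, ← sq_le_one_iff_abs_le_one]
    nlinarith
  have hy : -1 ≤ p.2 - q.2 ∧ p.2 - q.2 ≤ 1 := by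
    rw [← abs_le, ← sq_le_one_iff_abs_le_one]
    nlinarith
  obtain ⟨hx₁, hx₂⟩ := hx
  obtain ⟨hy₁, hy₂⟩ := hy
  generalize hx : p.1 - q.1 = x at *
  generalize hy : p.2 - q.2 = y at *
  interval_cases x <;> interval_cases y <;> omega

lemma inClass_iff_not_inClass_of_adj (h : adj (Sum.inl p) (Sum.inl q)) :
    InClass ε p ↔ ¬ InClass ε q := by
  have := cases_of_sq_add_sq_eq_one h
  simp only [InClass]
  omega

lemma Corner.mem_rectSet (hpz : Corner p z) (hz : Sum.inr z ∈ rectSet m n) :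
    Sum.inl p ∈ rectSet m n := by
  simp only [mem_rectSet_inl, mem_rectSet_inr, Corner] at *
  omega

lemma IsInterior.mem_rectSet (hp : IsInterior m n p) : Sum.inl p ∈ rectSet m n := by
  simp only [mem_rectSet_inl, IsInterior] at *
  omega

lemma IsInterior.face_mem_rectSet (hp : IsInterior m n p) (hpz : Corner p z) :
    Sum.inr z ∈ rectSet m n := by
  simp only [mem_rectSet_inr, IsInterior, Corner] at *
  omega

lemma finite_points (m n : ℕ) : {p : ℤ × ℤ | Sum.inl p ∈ rectSet m n}.Finite :=
  ((Set.finite_Icc (0 : ℤ) m).prod (Set.finite_Icc (0 : ℤ) n)).subset fun _ hp =>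
    ⟨⟨hp.1.1, hp.1.2⟩, hp.2.1, hp.2.2⟩

lemma finite_faces (m n : ℕ) : {z : ℤ × ℤ | Sum.inr z ∈ rectSet m n}.Finite :=
  (finite_points m n).subset fun z hz => Corner.mem_rectSet (p := z) (by simp [Corner]) hz

/-- The four faces with corner `v`. -/
def facesAround (v : ℤ × ℤ) : Finset (ℤ × ℤ) :=
  {v, (v.1 - 1, v.2), (v.1 - 1, v.2 - 1), (v.1, v.2 - 1)}

lemma mem_facesAround : z ∈ facesAround v ↔ Corner v z := by
  simp only [facesAround, Finset.mem_insert, Finset.mem_singleton, Corner, Prod.ext_iff]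
  omega

lemma sum_facesAround {M : Type*} [AddCommMonoid M] (e : ℤ × ℤ → M) (a b : ℤ) :
    ∑ z ∈ facesAround (a, b), e z =
      e (a, b) + (e (a - 1, b) + (e (a - 1, b - 1) + e (a, b - 1))) := by
  rw [facesAround, Finset.sum_insert, Finset.sum_insert, Finset.sum_insert,
    Finset.sum_singleton] <;> grind

/-! ### Boundaries of sets of lattice points -/

/-- The faces that separate `R`, a set of points of class `ε`, from the other points of that
class. -/
def faceBoundary (ε : ℤ) (R : Set (ℤ × ℤ)) : Set (ℤ × ℤ) :=
  {z | ∃ p q, Corner p z ∧ Corner q z ∧ InClass ε p ∧ InClass ε q ∧ p ∈ R ∧ q ∉ R}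

/-- The points of the class opposite to `ε` all of whose neighbours are in `R`. -/
def core (ε : ℤ) (R : Set (ℤ × ℤ)) : Set (ℤ × ℤ) :=
  {v | InClass (ε + 1) v ∧ ∀ z p, Corner v z → Corner p z → InClass ε p → p ∈ R}

lemma opp_mem_faceBoundary_iff (hpz : Corner p z) (hp : InClass ε p) :
    z ∈ faceBoundary ε R ↔ ¬ (opp z p ∈ R ↔ p ∈ R) := by
  constructor
  · rintro ⟨a, b, haz, hbz, ha, hb, haR, hbR⟩
    rcases eq_or_eq_opp haz hpz ha hp with rfl | rfl <;>
      rcases eq_or_eq_opp hbz hpz hb hp with rfl | rfl <;> tauto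
  · intro h
    by_cases hpR : p ∈ R
    · exact ⟨_, _, hpz, corner_opp hpz, hp, inClass_opp.2 hp, hpR, by tauto⟩
    · exact ⟨_, _, corner_opp hpz, hpz, inClass_opp.2 hp, hp, by tauto, hpR⟩

lemma mem_faceBoundary_iff (hpz : Corner p z) (hqz : Corner q z) (hp : InClass ε p)
    (hq : InClass ε q) (hne : q ≠ p) : z ∈ faceBoundary ε R ↔ ¬ (q ∈ R ↔ p ∈ R) := by
  obtain rfl := (eq_or_eq_opp hqz hpz hq hp).resolve_left hne
  exact opp_mem_faceBoundary_iff hpz hp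

lemma mem_faceBoundary_around (hv : InClass (ε + 1) v) :
    (v ∈ faceBoundary ε R ↔ ¬ ((v.1, v.2 + 1) ∈ R ↔ (v.1 + 1, v.2) ∈ R)) ∧
    ((v.1 - 1, v.2) ∈ faceBoundary ε R ↔ ¬ ((v.1 - 1, v.2) ∈ R ↔ (v.1, v.2 + 1) ∈ R)) ∧
    ((v.1 - 1, v.2 - 1) ∈ faceBoundary ε R ↔ ¬ ((v.1, v.2 - 1) ∈ R ↔ (v.1 - 1, v.2) ∈ R)) ∧
    ((v.1, v.2 - 1) ∈ faceBoundary ε R ↔ ¬ ((v.1 + 1, v.2) ∈ R ↔ (v.1, v.2 - 1) ∈ R)) := by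
  simp only [InClass] at hv
  refine ⟨?_, ?_, ?_, ?_⟩ <;> apply mem_faceBoundary_iff <;>
    first
    | simp [Corner]
    | (simp only [InClass]; omega)

lemma exists_ne_mem_faceBoundary (hv : InClass (ε + 1) v) (hz : z ∈ faceBoundary ε R)
    (hvz : Corner v z) : ∃ z' ∈ faceBoundary ε R, z' ≠ z ∧ Corner v z' := by
  obtain ⟨a, b⟩ := v
  have around := mem_faceBoundary_around (R := R) hv
  by_contra! hcon
  have unique : ∀ z' ∈ facesAround (a, b), z' ≠ z → z' ∉ faceBoundary ε R :=
    fun z' hz' hne h => hcon z' h hne (mem_facesAround.1 hz')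
  rw [← mem_facesAround] at hvz
  simp only [facesAround, Finset.mem_insert, Finset.mem_singleton] at hvz unique
  grind

lemma mem_core_of_not_touched (hv : InClass (ε + 1) v) (hp : InClass ε p) (hpR : p ∈ R)
    (hpz : Corner p z) (hvz : Corner v z) (hnot : ∀ z' ∈ faceBoundary ε R, ¬ Corner v z') :
    v ∈ core ε R := by
  obtain ⟨h₁, h₂, h₃, h₄⟩ := mem_faceBoundary_around (R := R) hv
  rw [iff_not_comm, iff_true_right fun h => hnot _ h (by simp [Corner])] at h₁ h₂ h₃ h₄
  refine ⟨hv, fun z' q hvz' hqz' hq => ?_⟩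
  rcases eq_or_of_corner hv hp hvz hpz with rfl | rfl | rfl | rfl <;>
    rcases eq_or_of_corner hv hq hvz' hqz' with rfl | rfl | rfl | rfl <;> tauto

end Lattice

/-! ### A discrete Jordan curve theorem modulo 2 -/

section Jordan
variable {m n : ℕ} {ε : ℤ} {e : ℤ × ℤ → ZMod 2} {y : ℤ × ℤ}

/-- The sum of `e` over the faces on the diagonal ray that starts at `y`, up to the right side of
the rectangle. -/
noncomputable def raySum (m : ℕ) (e : ℤ × ℤ → ZMod 2) (y : ℤ × ℤ) : ZMod 2 :=
  ∑ i ∈ Finset.Ico y.1 (m : ℤ), e (i, i + y.2 - y.1)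

lemma raySum_eq_zero_of_right (h : (m : ℤ) ≤ y.1) : raySum m e y = 0 := by
  rw [raySum, Finset.Ico_eq_empty (by omega), Finset.sum_empty]

lemma exists_of_raySum_ne_zero (h : raySum m e y ≠ 0) :
    ∃ k : ℤ, 0 ≤ k ∧ e (y.1 + k, y.2 + k) ≠ 0 := by
  obtain ⟨i, hi, hne⟩ := Finset.exists_ne_zero_of_sum_ne_zero h
  rw [Finset.mem_Ico] at hi
  refine ⟨i - y.1, by omega, ?_⟩
  convert hne using 3 <;> ring

/-- `e` is a cycle modulo 2 in the rectangle, when a face is regarded as an edge between its two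
corners of class `ε`. -/
structure IsFaceCycle (m n : ℕ) (ε : ℤ) (e : ℤ × ℤ → ZMod 2) : Prop where
  mem_rectSet : ∀ z, e z ≠ 0 → Sum.inr z ∈ rectSet m n
  sum_eq_zero : ∀ v, InClass ε v → ∑ z ∈ facesAround v, e z = 0

namespace IsFaceCycle

lemma apply_eq_zero (he : IsFaceCycle m n ε e) {z : ℤ × ℤ}
    (hz : z.1 < 0 ∨ m ≤ z.1 ∨ z.2 < 0 ∨ n ≤ z.2) : e z = 0 := by
  by_contra hne
  have := mem_rectSet_inr.1 (he.mem_rectSet z hne)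
  omega

lemma raySum_eq_add (he : IsFaceCycle m n ε e) (a b : ℤ) :
    raySum m e (a, b) = e (a, b) + raySum m e (a + 1, b + 1) := by
  rw [raySum, raySum]
  by_cases h : a < m
  · rw [← Finset.insert_Ico_add_one_left_eq_Ico h, Finset.sum_insert (by simp)]
    congr 1
    · rw [add_sub_cancel_left]
    · exact Finset.sum_congr rfl fun i _ => by rw [show i + (b + 1) - (a + 1) = i + b - a by ring]
  · rw [he.apply_eq_zero (by omega), Finset.Ico_eq_empty h, Finset.Ico_eq_empty (by omega),
      Finset.sum_empty, Finset.sum_empty, add_zero]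

lemma raySum_eq_zero_of_top (he : IsFaceCycle m n ε e) (h : (n : ℤ) ≤ y.2) :
    raySum m e y = 0 := by
  by_contra hne
  obtain ⟨k, hk, hne⟩ := exists_of_raySum_ne_zero hne
  exact hne (he.apply_eq_zero (by simp only; omega))

lemma raySum_add_raySum (he : IsFaceCycle m n ε e) (k : ℕ) : ∀ a b : ℤ, (m : ℤ) ≤ a + k →
    InClass (ε + 1) (a, b) → raySum m e (a, b) + raySum m e (a + 1, b - 1) = e (a, b - 1) := by
  induction k with
  | zero =>
    intro a b hm _
    have hma : (m : ℤ) ≤ a := by simpa using hm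
    rw [raySum_eq_zero_of_right hma, raySum_eq_zero_of_right (by simp only; omega),
      he.apply_eq_zero (by simp only; omega), add_zero]
  | succ k ih =>
    intro a b hm hab
    have shifted := ih (a + 1) (b + 1) (by push_cast at hm; omega)
      (by simp only [InClass] at *; omega)
    have around := he.sum_eq_zero (a + 1, b) (by simp only [InClass] at *; omega)
    rw [sum_facesAround] at around
    rw [he.raySum_eq_add a b, he.raySum_eq_add (a + 1) (b - 1)]
    simp only [add_sub_cancel_right, sub_add_cancel] at *
    linear_combination shifted + around - e (a, b - 1) * CharTwo.two_eq_zero (R := ZMod 2)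

lemma raySum_add_raySum_eq (he : IsFaceCycle m n ε e) {a b : ℤ} (hab : InClass ε (a, b)) :
    raySum m e (a, b + 1) + raySum m e (a + 1, b) = e (a, b) := by
  have := he.raySum_add_raySum (m - a).toNat a (b + 1) (by omega)
    (by simp only [InClass] at *; omega)
  rwa [add_sub_cancel_right] at this

lemma raySum_eq_zero_of_left (he : IsFaceCycle m n ε e) (k : ℕ) : ∀ a b : ℤ, (n : ℤ) ≤ b + k →
    a ≤ 0 → InClass (ε + 1) (a, b) → raySum m e (a, b) = 0 := by
  induction k with
  | zero => exact fun a b hn _ _ => he.raySum_eq_zero_of_top (by simpa using hn)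
  | succ k ih =>
    intro a b hn ha hab
    have hadd := he.raySum_add_raySum_eq (a := a - 1) (b := b)
      (by simp only [InClass] at *; omega)
    rwa [ih (a - 1) (b + 1) (by push_cast at hn; omega) (by omega)
      (by simp only [InClass] at *; omega), zero_add, sub_add_cancel,
      he.apply_eq_zero (by simp only; omega)] at hadd

lemma raySum_eq_zero_of_bottom (he : IsFaceCycle m n ε e) (k : ℕ) : ∀ a b : ℤ,
    (m : ℤ) ≤ a + k → b ≤ 0 → InClass (ε + 1) (a, b) → raySum m e (a, b) = 0 := by
  induction k with
  | zero => exact fun a b hm _ _ => raySum_eq_zero_of_right (by simpa using hm)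
  | succ k ih =>
    intro a b hm hb hab
    have hadd := he.raySum_add_raySum_eq (a := a) (b := b - 1)
      (by simp only [InClass] at *; omega)
    rwa [ih (a + 1) (b - 1) (by push_cast at hm; omega) (by omega)
      (by simp only [InClass] at *; omega), add_zero, sub_add_cancel,
      he.apply_eq_zero (by simp only; omega)] at hadd

lemma isInterior_of_raySum_ne_zero (he : IsFaceCycle m n ε e) (hy : InClass (ε + 1) y)
    (hne : raySum m e y ≠ 0) : IsInterior m n y := by
  refine ⟨?_, ?_, ?_, ?_⟩ <;> by_contra! hle <;> refine hne ?_
  · exact he.raySum_eq_zero_of_left (n - y.2).toNat y.1 y.2 (by omega) hle hy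
  · exact raySum_eq_zero_of_right hle
  · exact he.raySum_eq_zero_of_bottom (m - y.1).toNat y.1 y.2 (by omega) hle hy
  · exact he.raySum_eq_zero_of_top hle

lemma raySum_opp_add_raySum (he : IsFaceCycle m n ε e) {z p : ℤ × ℤ} (hpz : Corner p z)
    (hp : InClass (ε + 1) p) : raySum m e (opp z p) + raySum m e p = e z := by
  have self_add : ∀ s t : ZMod 2, s + t + t = s := by decide
  obtain ⟨a, b⟩ := z
  have diag := he.raySum_eq_add a b
  have antidiag := he.raySum_add_raySum_eq (a := a) (b := b)
  obtain ⟨c, d⟩ := p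
  simp only [Corner, opp, InClass] at *
  obtain ⟨rfl | rfl, rfl | rfl⟩ := hpz
  · rw [show 2 * c + 1 - c = c + 1 by ring, show 2 * d + 1 - d = d + 1 by ring, diag, add_comm,
      self_add]
  · rw [show 2 * c + 1 - c = c + 1 by ring, show 2 * b + 1 - (b + 1) = b by ring, add_comm,
      antidiag (by omega)]
  · rw [show 2 * a + 1 - (a + 1) = a by ring, show 2 * d + 1 - d = d + 1 by ring,
      antidiag (by omega)]
  · rw [show 2 * a + 1 - (a + 1) = a by ring, show 2 * b + 1 - (b + 1) = b by ring, diag,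
      self_add]

end IsFaceCycle

theorem exists_faceBoundary_eq {E : Set (ℤ × ℤ)} (hE : ∀ z ∈ E, Sum.inr z ∈ rectSet m n)
    (heven : ∀ v, InClass ε v → Even {z ∈ E | Corner v z}.ncard) :
    ∃ S : Set (ℤ × ℤ), faceBoundary (ε + 1) S = E ∧ ∀ y ∈ S, InClass (ε + 1) y ∧
      IsInterior m n y ∧ ∃ k : ℤ, 0 ≤ k ∧ (y.1 + k, y.2 + k) ∈ E := by
  classical
  let e : ℤ × ℤ → ZMod 2 := fun z => if z ∈ E then 1 else 0
  have e_ne_zero : ∀ z, e z ≠ 0 ↔ z ∈ E := fun z => by simp [e]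
  have he : IsFaceCycle m n ε e := by
    refine ⟨fun z hz => hE z ((e_ne_zero z).1 hz), fun v hv => ?_⟩
    rw [← Finset.natCast_card_filter, ZMod.natCast_eq_zero_iff_even]
    convert heven v hv
    rw [← Set.ncard_coe_finset]
    congr 1
    ext z
    simp [mem_facesAround, and_comm]
  have iff_add : ∀ s t : ZMod 2, ¬ (s ≠ 0 ↔ t ≠ 0) ↔ s + t ≠ 0 := by decide
  refine ⟨{y | InClass (ε + 1) y ∧ raySum m e y ≠ 0}, ?_, ?_⟩
  · ext z
    obtain ⟨p, hpz, hp⟩ := exists_corner_inClass (ε + 1) z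
    rw [opp_mem_faceBoundary_iff hpz hp, Set.mem_ofPred_eq, Set.mem_ofPred_eq, inClass_opp,
      and_iff_right hp, and_iff_right hp, iff_add, he.raySum_opp_add_raySum hpz hp, e_ne_zero]
  · rintro y ⟨hy, hne⟩
    obtain ⟨k, hk, hkE⟩ := exists_of_raySum_ne_zero hne
    exact ⟨hy, he.isInterior_of_raySum_ne_zero hy hne, k, hk, (e_ne_zero _).1 hkE⟩

end Jordan

/-! ### The map `next` of a dimer covering -/

namespace DimerCovering

section Mate
variable {V : Type*} {G : SimpleGraph V} (M : DimerCovering G)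

lemma existsUnique_mate (v : V) : ∃ w, ∀ u, s(v, u) ∈ M.1 ↔ u = w := by
  obtain ⟨e, ⟨he, w, rfl⟩, unique⟩ := M.2.2 v
  exact ⟨w, fun u => ⟨fun hu => Sym2.congr_right.1 (unique _ ⟨hu, Sym2.mem_mk_left _ _⟩),
    fun hu => hu ▸ he⟩⟩

/-- The vertex with which `v` is matched. -/
noncomputable def mate (v : V) : V := (M.existsUnique_mate v).choose

lemma mem_iff {v w : V} : s(v, w) ∈ M.1 ↔ w = M.mate v := (M.existsUnique_mate v).choose_spec w

lemma mk_mate_mem (v : V) : s(v, M.mate v) ∈ M.1 := M.mem_iff.2 rfl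

lemma adj_mate (v : V) : G.Adj v (M.mate v) := M.2.1 (M.mk_mate_mem v)

lemma mate_mate (v : V) : M.mate (M.mate v) = v := by
  symm
  rw [← M.mem_iff, Sym2.eq_swap]
  exact M.mk_mate_mem v

lemma ext_mate {M M' : DimerCovering G} (h : ∀ v, M.mate v = M'.mate v) : M = M' := by
  apply Subtype.ext
  ext e
  induction e using Sym2.ind with
  | _ v w => rw [M.mem_iff, M'.mem_iff, h]

end Mate

variable {m n : ℕ} {ε : ℤ} {p q z : ℤ × ℤ} (M : DimerCovering (rect m n))

open Classical in
/-- The matching as an involution of all vertices of the radial graph, extended by the identity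
outside the rectangle. -/
noncomputable def partner (v : Vertex) : Vertex :=
  if h : v ∈ rectSet m n then M.mate ⟨v, h⟩ else v

lemma partner_coe (v : rectSet m n) : M.partner v = M.mate v := dif_pos v.2

lemma partner_partner (v : Vertex) : M.partner (M.partner v) = v := by
  by_cases h : v ∈ rectSet m n
  · lift v to rectSet m n using h
    rw [partner_coe, partner_coe, mate_mate]
  · have hv : M.partner v = v := dif_neg h
    rw [hv, hv]

lemma adj_partner {v : Vertex} (hv : v ∈ rectSet m n) : adj v (M.partner v) := by
  lift v to rectSet m n using hv
  rw [partner_coe]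
  exact M.adj_mate v

lemma face_mem_rectSet (h : M.partner (Sum.inl p) = Sum.inr z) : Sum.inr z ∈ rectSet m n := by
  by_cases hp : Sum.inl p ∈ rectSet m n
  · rw [← h, M.partner_coe ⟨_, hp⟩]
    exact (M.mate _).2
  · rw [partner, dif_neg hp] at h
    cases h

lemma exists_partner_eq (hz : Sum.inr z ∈ rectSet m n) :
    ∃ p, M.partner (Sum.inl p) = Sum.inr z := by
  have hadj := M.adj_partner hz
  rcases h : M.partner (Sum.inr z) with p | q
  · exact ⟨p, by rw [← h, partner_partner]⟩
  · rw [h] at hadj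
    exact hadj.elim

lemma corner_of_partner_eq (h : M.partner (Sum.inl p) = Sum.inr z) : Corner p z := by
  have hz := M.adj_partner (M.face_mem_rectSet h)
  rwa [← h, partner_partner, h] at hz

lemma eq_of_partner_eq (hp : M.partner (Sum.inl p) = Sum.inr z)
    (hq : M.partner (Sum.inl q) = Sum.inr z) : p = q := by
  rw [← hq] at hp
  simpa only [partner_partner, Sum.inl.injEq] using congrArg M.partner hp

/-- The corner opposite to `p` of the face matched with `p`; `p` itself if `p` is matched with a
lattice point. Following `next` traces a tree of the forests from a vertex towards its root. -/
noncomputable def next (p : ℤ × ℤ) : ℤ × ℤ :=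
  Sum.elim (fun _ => p) (fun z => opp z p) (M.partner (Sum.inl p))

variable {M}

lemma next_of_inr (h : M.partner (Sum.inl p) = Sum.inr z) : M.next p = opp z p := by
  rw [next, h, Sum.elim_inr]

lemma next_of_inl (h : M.partner (Sum.inl p) = Sum.inl q) : M.next p = p := by
  rw [next, h, Sum.elim_inl]

lemma next_eq_self_iff : M.next p = p ↔ ∃ q, M.partner (Sum.inl p) = Sum.inl q := by
  rcases h : M.partner (Sum.inl p) with q | z
  · simp [next_of_inl h]
  · simp [next_of_inr h, opp_ne]

lemma exists_face_of_next_ne (h : M.next p ≠ p) : ∃ z, M.partner (Sum.inl p) = Sum.inr z := by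
  rcases hp : M.partner (Sum.inl p) with q | z
  · exact absurd (next_of_inl hp) h
  · exact ⟨z, rfl⟩

lemma inClass_next : InClass ε (M.next p) ↔ InClass ε p := by
  rcases h : M.partner (Sum.inl p) with q | z
  · rw [next_of_inl h]
  · rw [next_of_inr h, inClass_opp]

lemma mapsTo_next : Set.MapsTo M.next {p | Sum.inl p ∈ rectSet m n}
    {p | Sum.inl p ∈ rectSet m n} := by
  intro p hp
  rcases h : M.partner (Sum.inl p) with q | z
  · rwa [next_of_inl h]
  · rw [next_of_inr h]
    exact (corner_opp (M.corner_of_partner_eq h)).mem_rectSet (M.face_mem_rectSet h)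

lemma exists_face_partner_eq {E : Set (ℤ × ℤ)} (hE : ∀ z ∈ E, Sum.inr z ∈ rectSet m n)
    (hclass : ∀ z ∈ E, ∀ p, M.partner (Sum.inl p) = Sum.inr z → InClass ε p)
    (htwo : ∀ p, InClass ε p → ∀ z ∈ E, Corner p z → ∃ z' ∈ E, z' ≠ z ∧ Corner p z')
    (hp : InClass ε p) (hz : z ∈ E) (hpz : Corner p z) :
    ∃ z' ∈ E, M.partner (Sum.inl p) = Sum.inr z' := by
  have hfin : E.Finite := (finite_faces m n).subset hE
  choose! c hc using fun z hz => M.exists_partner_eq (hE z hz)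
  let T : Set (ℤ × ℤ) := {p | InClass ε p ∧ ∃ z ∈ E, Corner p z}
  have maps_c : Set.MapsTo c E T := fun z hz =>
    ⟨hclass z hz _ (hc z hz), z, hz, M.corner_of_partner_eq (hc z hz)⟩
  have injOn_c : Set.InjOn c E := fun z hz z' hz' h =>
    Sum.inr.inj ((hc z hz).symm.trans (h ▸ hc z' hz'))
  -- As a point of `T` is not matched with both of its faces in `E`, `T` has at most as many points
  -- as `E` has faces, and `c` is a bijection.
  have surjOn_opp : Set.SurjOn (fun z => opp z (c z)) E T := by
    rintro w ⟨hw, z, hz, hwz⟩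
    obtain ⟨z', hz', hne, hwz'⟩ := htwo w hw z hz hwz
    rcases eq_or_eq_opp hwz (M.corner_of_partner_eq (hc z hz)) hw (maps_c hz).1 with h | h
    · rcases eq_or_eq_opp hwz' (M.corner_of_partner_eq (hc z' hz')) hw (maps_c hz').1 with h' | h'
      · exact absurd (injOn_c hz' hz (h'.symm.trans h)) hne
      · exact ⟨z', hz', h'.symm⟩
    · exact ⟨z, hz, h.symm⟩
  have card_le : T.ncard ≤ (c '' E).ncard := by
    rw [injOn_c.ncard_image]
    exact (Set.ncard_le_ncard surjOn_opp (hfin.image _)).trans (Set.ncard_image_le hfin)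
  have image_c : c '' E = T := Set.eq_of_subset_of_ncard_le maps_c.image_subset card_le
    ((hfin.image _).subset surjOn_opp)
  obtain ⟨z', hz', rfl⟩ : p ∈ c '' E := image_c ▸ ⟨hp, z, hz, hpz⟩
  exact ⟨z', hz', hc z' hz'⟩

end DimerCovering

/-! ### Enclosed sets and the absence of cycles -/

namespace DimerCovering
variable {m n : ℕ} {ε : ℤ} {p q r v w z : ℤ × ℤ} {R O : Set (ℤ × ℤ)}
  {M : DimerCovering (rect m n)}

/-- `R` is a set of interior points of class `ε` that is invariant under `next` and its
inverse: a union of components of the graph that joins each point with its image under `next`. -/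
structure IsEnclosed (M : DimerCovering (rect m n)) (ε : ℤ) (R : Set (ℤ × ℤ)) : Prop where
  inClass : ∀ p ∈ R, InClass ε p
  isInterior : ∀ p ∈ R, IsInterior m n p
  next_mem_iff : ∀ p, InClass ε p → (M.next p ∈ R ↔ p ∈ R)

namespace IsEnclosed

lemma face_mem_rectSet (hR : M.IsEnclosed ε R) (hz : z ∈ faceBoundary ε R) :
    Sum.inr z ∈ rectSet m n := by
  obtain ⟨p, -, hpz, -, -, -, hpR, -⟩ := hz
  exact (hR.isInterior p hpR).face_mem_rectSet hpz

lemma inClass_of_partner_eq (hR : M.IsEnclosed ε R) (hz : z ∈ faceBoundary ε R)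
    (h : M.partner (Sum.inl p) = Sum.inr z) : InClass (ε + 1) p := by
  rw [inClass_add_one_iff]
  intro hp
  have hiff := hR.next_mem_iff p hp
  rw [next_of_inr h] at hiff
  exact (opp_mem_faceBoundary_iff (M.corner_of_partner_eq h) hp).1 hz hiff

lemma exists_face_partner_eq (hR : M.IsEnclosed ε R) (hv : InClass (ε + 1) v)
    (hz : z ∈ faceBoundary ε R) (hvz : Corner v z) :
    ∃ z' ∈ faceBoundary ε R, M.partner (Sum.inl v) = Sum.inr z' :=
  DimerCovering.exists_face_partner_eq (fun _ => hR.face_mem_rectSet)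
    (fun _ hz _ => hR.inClass_of_partner_eq hz)
    (fun _ hv _ hz hvz => exists_ne_mem_faceBoundary hv hz hvz) hv hz hvz

lemma not_touched_of_iterate_eq (hR : M.IsEnclosed ε R)
    (hwr : M.partner (Sum.inl w) = Sum.inl r) (k : ℕ) : ∀ v, InClass (ε + 1) v →
      M.next^[k] v = w → ∀ z ∈ faceBoundary ε R, ¬ Corner v z := by
  induction k with
  | zero =>
    rintro v hv rfl z hz hvz
    obtain ⟨z', -, h⟩ := hR.exists_face_partner_eq hv hz hvz
    cases h.symm.trans hwr
  | succ k ih =>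
    intro v hv hk z hz hvz
    obtain ⟨z', hz', h⟩ := hR.exists_face_partner_eq hv hz hvz
    refine ih _ (inClass_next.2 hv) hk z' hz' ?_
    rw [next_of_inr h]
    exact corner_opp (M.corner_of_partner_eq h)

end IsEnclosed

lemma neighbours_mem_of_mem_core (hv : v ∈ core ε R) : (v.1 + 1, v.2) ∈ R ∧
    (v.1, v.2 + 1) ∈ R ∧ (v.1 - 1, v.2) ∈ R ∧ (v.1, v.2 - 1) ∈ R := by
  obtain ⟨hv, hR⟩ := hv
  simp only [InClass] at hv
  refine ⟨hR v _ ?_ ?_ ?_, hR v _ ?_ ?_ ?_, hR (v.1 - 1, v.2 - 1) _ ?_ ?_ ?_,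
    hR (v.1 - 1, v.2 - 1) _ ?_ ?_ ?_⟩
  all_goals
    dsimp only [InClass, Corner]
    omega

lemma mem_core_of_corner (hv : v ∈ core ε R) (hvz : Corner v z) (hwz : Corner w z)
    (hw : InClass (ε + 1) w) (hnot : ∀ z' ∈ faceBoundary ε R, ¬ Corner w z') : w ∈ core ε R := by
  obtain ⟨p, hpz, hp⟩ := exists_corner_inClass ε z
  exact mem_core_of_not_touched hw hp (hv.2 z p hvz hpz hp) hpz hwz hnot

namespace IsEnclosed

/-- No boundary face of `R` has a corner in the tree rooted at `w`, so a path in this tree cannot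
leave the core of `R`. -/
lemma inter_core (hR : M.IsEnclosed ε R) (hwr : M.partner (Sum.inl w) = Sum.inl r) :
    M.IsEnclosed (ε + 1) (core ε R ∩ {v | ∃ k, M.next^[k] v = w}) where
  inClass := fun v hv => hv.1.1
  isInterior := by
    intro v hv
    obtain ⟨h₁, h₂, h₃, h₄⟩ := neighbours_mem_of_mem_core hv.1
    have := hR.isInterior _ h₁
    have := hR.isInterior _ h₂
    have := hR.isInterior _ h₃
    have := hR.isInterior _ h₄
    simp only [IsInterior] at *
    omega
  next_mem_iff := by
    intro p hp
    rw [Set.mem_inter_iff, Set.mem_inter_iff, Set.mem_ofPred_eq, Set.mem_ofPred_eq,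
      exists_iterate_apply_iff (next_of_inl hwr)]
    refine and_congr_left fun hpw => ?_
    obtain ⟨k', hk'⟩ := (exists_iterate_apply_iff (next_of_inl hwr)).2 hpw
    obtain ⟨k, hk⟩ := hpw
    rcases h : M.partner (Sum.inl p) with q | z
    · rw [next_of_inl h]
    · have hpz := M.corner_of_partner_eq h
      have hnz : Corner (M.next p) z := next_of_inr h ▸ corner_opp hpz
      exact ⟨fun hnext =>
          mem_core_of_corner hnext hnz hpz hp (hR.not_touched_of_iterate_eq hwr k p hp hk),
        fun hpc => mem_core_of_corner hpc hpz hnz (inClass_next.2 hp)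
          (hR.not_touched_of_iterate_eq hwr k' _ (inClass_next.2 hp) hk')⟩

end IsEnclosed

lemma IsEnclosed.exists_of_root (hR : M.IsEnclosed ε R) (hr : r ∈ R) (hroot : M.next r = r) :
    ∃ Q, M.IsEnclosed (ε + 1) Q ∧ Q.Nonempty ∧ ∀ q ∈ Q, ∃ p ∈ R, q.1 + q.2 < p.1 + p.2 := by
  obtain ⟨w, hrw⟩ := next_eq_self_iff.1 hroot
  have hwr : M.partner (Sum.inl w) = Sum.inl r := by rw [← hrw, partner_partner]
  have hadj := M.adj_partner (hR.isInterior r hr).mem_rectSet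
  rw [hrw] at hadj
  replace hadj := cases_of_sq_add_sq_eq_one hadj
  have hrε := hR.inClass r hr
  have hw : InClass (ε + 1) w := by
    simp only [InClass] at *
    omega
  have hw_core : w ∈ core ε R := by
    refine mem_core_of_not_touched (z := (min r.1 w.1, min r.2 w.2)) hw hrε hr ?_ ?_
      (hR.not_touched_of_iterate_eq hwr 0 w hw rfl) <;> simp only [Corner] <;> omega
  refine ⟨_, hR.inter_core hwr, ⟨w, hw_core, 0, rfl⟩, fun q hq => ?_⟩
  exact ⟨_, (neighbours_mem_of_mem_core hq.1).1, by simp only; omega⟩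

/-- Around each point of an orbit there are two faces matched with the orbit: the one matched with
the point itself, and the one matched with its predecessor. -/
lemma even_ncard_faces (hO : ∀ v ∈ O, InClass ε v ∧ M.next v ≠ v) (hbij : Set.BijOn M.next O O)
    (hp : InClass ε p) :
    Even {z ∈ {z | ∃ v ∈ O, M.partner (Sum.inl v) = Sum.inr z} | Corner p z}.ncard := by
  have eq_or_next_eq : ∀ z v, v ∈ O → M.partner (Sum.inl v) = Sum.inr z → Corner p z →
      v = p ∨ M.next v = p := by
    intro z v hv hvz hpz
    rw [next_of_inr hvz]
    exact (eq_or_eq_opp hpz (M.corner_of_partner_eq hvz) hp (hO v hv).1).imp Eq.symm Eq.symm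
  by_cases hpO : p ∈ O
  · obtain ⟨z₁, hz₁⟩ := exists_face_of_next_ne (hO p hpO).2
    obtain ⟨u, hu, hup⟩ := hbij.surjOn hpO
    obtain ⟨z₂, hz₂⟩ := exists_face_of_next_ne (hO u hu).2
    have hne : z₁ ≠ z₂ := by
      rintro rfl
      exact (hO u hu).2 (hup.trans (M.eq_of_partner_eq hz₁ hz₂))
    have hpz₂ : Corner p z₂ := by
      rw [← hup, next_of_inr hz₂]
      exact corner_opp (M.corner_of_partner_eq hz₂)
    suffices h : {z ∈ {z | ∃ v ∈ O, M.partner (Sum.inl v) = Sum.inr z} | Corner p z} = {z₁, z₂} by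
      rw [h, Set.ncard_pair hne]
      exact even_two
    refine Set.Subset.antisymm ?_ (Set.pair_subset ⟨⟨p, hpO, hz₁⟩, M.corner_of_partner_eq hz₁⟩
      ⟨⟨u, hu, hz₂⟩, hpz₂⟩)
    rintro z ⟨⟨v, hv, hvz⟩, hpz⟩
    rcases eq_or_next_eq z v hv hvz hpz with rfl | h
    · exact Or.inl (Sum.inr.inj (hvz.symm.trans hz₁))
    · obtain rfl := hbij.injOn hv hu (h.trans hup.symm)
      exact Or.inr (Sum.inr.inj (hvz.symm.trans hz₂))
  · suffices h : {z ∈ {z | ∃ v ∈ O, M.partner (Sum.inl v) = Sum.inr z} | Corner p z} = ∅ by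
      rw [h, Set.ncard_empty]
      exact Even.zero
    refine Set.eq_empty_of_forall_notMem ?_
    rintro z ⟨⟨v, hv, hvz⟩, hpz⟩
    rcases eq_or_next_eq z v hv hvz hpz with rfl | rfl
    exacts [hpO hv, hpO (hbij.mapsTo hv)]

lemma exists_isEnclosed_of_bijOn (hO : ∀ v ∈ O, InClass ε v ∧ M.next v ≠ v)
    (hbij : Set.BijOn M.next O O) (hne : O.Nonempty) :
    ∃ Q, M.IsEnclosed (ε + 1) Q ∧ Q.Nonempty ∧ ∀ q ∈ Q, ∃ p ∈ O, q.1 + q.2 < p.1 + p.2 := by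
  obtain ⟨Q, hbdry, hQ⟩ := exists_faceBoundary_eq (m := m) (n := n)
    (E := {z | ∃ v ∈ O, M.partner (Sum.inl v) = Sum.inr z})
    (fun z ⟨v, _, hvz⟩ => M.face_mem_rectSet hvz) (fun v hv => even_ncard_faces hO hbij hv)
  refine ⟨Q, ⟨fun q hq => (hQ q hq).1, fun q hq => (hQ q hq).2.1, fun q hq => ?_⟩, ?_, ?_⟩
  · rcases h : M.partner (Sum.inl q) with r | z
    · rw [next_of_inl h]
    · rw [next_of_inr h, ← not_not (a := _ ↔ _),
        ← opp_mem_faceBoundary_iff (M.corner_of_partner_eq h) hq, hbdry]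
      rintro ⟨v, hv, hvz⟩
      rw [M.eq_of_partner_eq h hvz] at hq
      exact inClass_add_one_iff.1 hq (hO v hv).1
  · obtain ⟨v, hv⟩ := hne
    obtain ⟨z, hvz⟩ := exists_face_of_next_ne (hO v hv).2
    have hz : z ∈ faceBoundary (ε + 1) Q := hbdry ▸ ⟨v, hv, hvz⟩
    obtain ⟨p, -, -, -, -, -, hp, -⟩ := hz
    exact ⟨p, hp⟩
  · intro q hq
    obtain ⟨hq, -, k, hk, v, hv, hvz⟩ := hQ q hq
    refine ⟨v, hv, ?_⟩
    have hcorner := M.corner_of_partner_eq hvz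
    have hvε := (hO v hv).1
    simp only [InClass, Corner] at *
    omega

lemma IsEnclosed.exists_lt (hR : M.IsEnclosed ε R) (hne : R.Nonempty) :
    ∃ Q, M.IsEnclosed (ε + 1) Q ∧ Q.Nonempty ∧ ∀ q ∈ Q, ∃ p ∈ R, q.1 + q.2 < p.1 + p.2 := by
  by_cases hroot : ∃ r ∈ R, M.next r = r
  · obtain ⟨r, hr, hroot⟩ := hroot
    exact hR.exists_of_root hr hroot
  push Not at hroot
  have maps_next : Set.MapsTo M.next R R := fun p hp => (hR.next_mem_iff p (hR.inClass p hp)).2 hp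
  have hfin : R.Finite := (finite_points m n).subset fun p hp => (hR.isInterior p hp).mem_rectSet
  have hper := Function.bijOn_periodicPts M.next
  have hbij : Set.BijOn M.next (R ∩ Function.periodicPts M.next)
      (R ∩ Function.periodicPts M.next) := by
    refine ⟨maps_next.inter_inter hper.mapsTo, hper.injOn.mono Set.inter_subset_right, ?_⟩
    rintro _ ⟨hR', hper'⟩
    obtain ⟨q, hq, rfl⟩ := hper.surjOn hper'
    exact ⟨q, ⟨(hR.next_mem_iff q (inClass_next.1 (hR.inClass _ hR'))).1 hR', hq⟩, rfl⟩
  obtain ⟨p, hp⟩ := hne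
  obtain ⟨k, hk⟩ := exists_iterate_mem_periodicPts hfin maps_next hp
  obtain ⟨Q, hQ, hQne, hlt⟩ := exists_isEnclosed_of_bijOn
    (fun v hv => ⟨hR.inClass v hv.1, hroot v hv.1⟩) hbij ⟨_, maps_next.iterate k hp, hk⟩
  refine ⟨Q, hQ, hQne, fun q hq => ?_⟩
  obtain ⟨p, hp, hqp⟩ := hlt q hq
  exact ⟨p, hp.1, hqp⟩

theorem IsEnclosed.eq_empty (hR : M.IsEnclosed ε R) : R = ∅ := by
  suffices h : ∀ (N : ℕ) ε R, M.IsEnclosed ε R → (∀ p ∈ R, p.1 + p.2 < N) → R = ∅ by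
    refine h (m + n) ε R hR fun p hp => ?_
    have := hR.isInterior p hp
    simp only [IsInterior] at this
    omega
  intro N
  induction N with
  | zero =>
    intro ε R hR hlt
    refine Set.eq_empty_of_forall_notMem fun p hp => ?_
    have := hR.isInterior p hp
    have := hlt p hp
    simp only [IsInterior] at *
    omega
  | succ N ih =>
    intro ε R hR hlt
    by_contra hne
    obtain ⟨Q, hQ, hQne, hQR⟩ := hR.exists_lt (Set.nonempty_iff_ne_empty.2 hne)
    refine hQne.ne_empty (ih _ Q hQ fun q hq => ?_)
    obtain ⟨p, hp, hqp⟩ := hQR q hq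
    have := hlt p hp
    push_cast at this
    omega

lemma next_eq_self_of_mem_periodicPts (hp : p ∈ Function.periodicPts M.next) : M.next p = p := by
  by_contra hne
  obtain ⟨ε, hε⟩ : ∃ ε, InClass ε p := ⟨p.1 + p.2, by simp only [InClass]; omega⟩
  let O : Set (ℤ × ℤ) := {v | v ∈ Function.periodicPts M.next ∧ InClass ε v ∧ M.next v ≠ v}
  have hper := Function.bijOn_periodicPts M.next
  have hbij : Set.BijOn M.next O O := by
    refine ⟨?_, hper.injOn.mono fun v hv => hv.1, ?_⟩
    · rintro v ⟨hv, hvε, hvne⟩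
      exact ⟨hper.mapsTo hv, inClass_next.2 hvε, fun h => hvne (hper.injOn (hper.mapsTo hv) hv h)⟩
    · rintro _ ⟨hv, hvε, hvne⟩
      obtain ⟨u, hu, rfl⟩ := hper.surjOn hv
      exact ⟨u, ⟨hu, inClass_next.1 hvε, fun h => hvne (congrArg M.next h)⟩, rfl⟩
  obtain ⟨Q, hQ, hQne, -⟩ := exists_isEnclosed_of_bijOn (fun v hv => hv.2) hbij ⟨p, hp, hε, hne⟩
  exact hQne.ne_empty hQ.eq_empty

theorem next_terminates (hp : Sum.inl p ∈ rectSet m n) :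
    ∃ k, M.next (M.next^[k] p) = M.next^[k] p := by
  obtain ⟨k, hk⟩ := exists_iterate_mem_periodicPts (finite_points m n) mapsTo_next hp
  exact ⟨k, next_eq_self_of_mem_periodicPts hk⟩

end DimerCovering

/-! ### The vertex classes of the rectangle -/

section VertexClasses
variable {m n : ℕ} {ε : ℤ} {W : Set (rectSet m n)} {v w z z' : rectSet m n}

instance : Finite (rectSet m n) := by
  refine Set.Finite.to_subtype <|
    (((finite_points m n).image Sum.inl).union ((finite_faces m n).image Sum.inr)).subset ?_
  rintro (p | z) hv
  exacts [Or.inl ⟨p, hv, rfl⟩, Or.inr ⟨z, hv, rfl⟩]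

/-- The coordinates of a vertex; a face centre has those of the lower left corner of the face. -/
def coord (v : rectSet m n) : ℤ × ℤ := Sum.elim id id v.1

/-- `W` is the set of the lattice points of class `ε` in the rectangle. -/
def IsClass (ε : ℤ) (W : Set (rectSet m n)) : Prop :=
  ∀ v, v ∈ W ↔ ∃ p, v.1 = Sum.inl p ∧ InClass ε p

lemma isClass_V₁ : IsClass 0 (V₁ m n) := by
  simp only [IsClass, V₁, InClass, Prod.exists, Set.mem_ofPred_eq, Int.even_iff]
  refine fun v => exists₂_congr fun x y => and_congr_right' ?_
  omega

lemma isClass_V₂ : IsClass 1 (V₂ m n) := by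
  simp only [IsClass, V₂, InClass, Prod.exists, Set.mem_ofPred_eq, Int.odd_iff]
  refine fun v => exists₂_congr fun x y => and_congr_right' ?_
  omega

lemma mem_V₃_iff : v ∈ V₃ m n ↔ ∃ z, v.1 = Sum.inr z :=
  ⟨fun ⟨x, y, h⟩ => ⟨(x, y), h⟩, fun ⟨⟨x, y⟩, h⟩ => ⟨x, y, h⟩⟩

lemma notMem_V₃_iff : v ∉ V₃ m n ↔ ∃ p, v.1 = Sum.inl p := by
  rw [mem_V₃_iff]
  rcases v.1 with p | z <;> simp

lemma compl_V₃ : (V₃ m n)ᶜ = V₁ m n ∪ V₂ m n := by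
  ext v
  rw [Set.mem_compl_iff, notMem_V₃_iff, Set.mem_union, isClass_V₁ v, isClass_V₂ v, ← exists_or]
  refine exists_congr fun p => ?_
  rw [← and_or_left, ← zero_add (1 : ℤ), inClass_add_one_iff, and_iff_left (em _)]

lemma disjoint_V₁_V₂ : Disjoint (V₁ m n) (V₂ m n) := by
  rw [Set.disjoint_left]
  intro v h₁ h₂
  obtain ⟨p, hp, hp₁⟩ := (isClass_V₁ v).1 h₁
  obtain ⟨q, hq, hq₂⟩ := (isClass_V₂ v).1 h₂
  obtain rfl := Sum.inl.inj (hp.symm.trans hq)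
  exact inClass_add_one_iff.1 hq₂ hp₁

lemma notMem_V₃_of_adj (h : (rect m n).Adj v w) (hv : v ∈ V₃ m n) : w ∉ V₃ m n := by
  rw [mem_V₃_iff] at *
  rintro ⟨z', hz'⟩
  obtain ⟨z, hz⟩ := hv
  change adj v.1 w.1 at h
  rwa [hz, hz'] at h

lemma mem_V₁_iff_mem_V₂_of_adj (h : (rect m n).Adj v w) (hv : v ∉ V₃ m n) (hw : w ∉ V₃ m n) :
    v ∈ V₁ m n ↔ w ∈ V₂ m n := by
  obtain ⟨p, hp⟩ := notMem_V₃_iff.1 hv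
  obtain ⟨q, hq⟩ := notMem_V₃_iff.1 hw
  change adj v.1 w.1 at h
  rw [hp, hq] at h
  rw [isClass_V₁ v, isClass_V₂ w]
  simp only [hp, hq, Sum.inl.injEq, exists_eq_left']
  exact (inClass_iff_not_inClass_of_adj h).trans inClass_add_one_iff.symm

lemma ncard_V₃ : (V₃ m n).ncard = m * n := by
  have himage : Subtype.val '' V₃ m n = Sum.inr '' (Set.Ico (0 : ℤ) m ×ˢ Set.Ico (0 : ℤ) n) := by
    ext v
    constructor
    · rintro ⟨v, hv, rfl⟩
      obtain ⟨z, hz⟩ := mem_V₃_iff.1 hv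
      exact ⟨z, mem_rectSet_inr.1 (hz ▸ v.2), hz.symm⟩
    · rintro ⟨z, hz, rfl⟩
      exact ⟨⟨Sum.inr z, hz⟩, mem_V₃_iff.2 ⟨z, rfl⟩, rfl⟩
  rw [← Set.ncard_image_of_injective _ Subtype.val_injective, himage,
    Set.ncard_image_of_injective _ Sum.inr_injective, Set.ncard_prod]
  simp [← Finset.coe_Ico, Set.ncard_coe_finset]

lemma ncard_compl_V₃ : (V₃ m n)ᶜ.ncard = (m + 1) * (n + 1) := by
  have himage : Subtype.val '' (V₃ m n)ᶜ = Sum.inl '' (Set.Icc (0 : ℤ) m ×ˢ Set.Icc (0 : ℤ) n) := by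
    ext v
    constructor
    · rintro ⟨v, hv, rfl⟩
      obtain ⟨p, hp⟩ := notMem_V₃_iff.1 hv
      exact ⟨p, mem_rectSet_inl.1 (hp ▸ v.2), hp.symm⟩
    · rintro ⟨p, hp, rfl⟩
      exact ⟨⟨Sum.inl p, hp⟩, notMem_V₃_iff.2 ⟨p, rfl⟩, rfl⟩
  rw [← Set.ncard_image_of_injective _ Subtype.val_injective, himage,
    Set.ncard_image_of_injective _ Sum.inl_injective, Set.ncard_prod]
  simp [← Finset.coe_Icc, Set.ncard_coe_finset]

lemma IsMiddle.symm (h : IsMiddle z v w) : IsMiddle z w v := ⟨h.1, h.2.2.symm, h.2.1.symm⟩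

namespace IsClass
variable (hW : IsClass ε W) {x x' y y' : W}
include hW

lemma coe_eq (x : W) : x.1.1 = Sum.inl (coord x.1) := by
  obtain ⟨p, hp, -⟩ := (hW x).1 x.2
  rw [coord, hp, Sum.elim_inl, id]

lemma inClass_coord (x : W) : InClass ε (coord x.1) := by
  obtain ⟨p, hp, hpε⟩ := (hW x).1 x.2
  rwa [coord, hp, Sum.elim_inl, id]

lemma notMem_V₃ (hv : v ∈ W) : v ∉ V₃ m n := notMem_V₃_iff.2 ⟨_, hW.coe_eq ⟨v, hv⟩⟩

lemma coord_inj : coord x.1 = coord y.1 ↔ x = y := by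
  rw [Subtype.ext_iff, Subtype.ext_iff, hW.coe_eq, hW.coe_eq, Sum.inl.injEq]

lemma isMiddle_iff (hne : x ≠ y) : IsMiddle z x.1 y.1 ↔
    z ∈ V₃ m n ∧ Corner (coord x.1) (coord z) ∧ coord y.1 = opp (coord z) (coord x.1) := by
  refine and_congr_right fun hz => ?_
  obtain ⟨c, hc⟩ := mem_V₃_iff.1 hz
  have hcoord : coord z = c := by rw [coord, hc, Sum.elim_inr, id]
  have hadj : ∀ u : W, (rect m n).Adj u.1 z ↔ Corner (coord u.1) c := by
    intro u
    change adj u.1.1 z.1 ↔ _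
    rw [hW.coe_eq, hc]
    rfl
  rw [SimpleGraph.adj_comm _ z, hadj, hadj, hcoord]
  refine and_congr_right fun hx => ⟨fun hy => ?_, fun hy => hy ▸ corner_opp hx⟩
  refine (eq_or_eq_opp hy hx (hW.inClass_coord y) (hW.inClass_coord x)).resolve_left fun h => ?_
  exact hne (hW.coord_inj.1 h.symm)

lemma middle_unique (hne : x ≠ y) (h : IsMiddle z x.1 y.1) (h' : IsMiddle z' x.1 y.1) :
    z = z' := by
  obtain ⟨hz, -, h⟩ := (hW.isMiddle_iff hne).1 h
  obtain ⟨hz', -, h'⟩ := (hW.isMiddle_iff hne).1 h'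
  obtain ⟨c, hc⟩ := mem_V₃_iff.1 hz
  obtain ⟨c', hc'⟩ := mem_V₃_iff.1 hz'
  rw [h] at h'
  simp only [coord, opp, hc, hc', Sum.elim_inr, id, Prod.mk.injEq] at h'
  apply Subtype.ext
  rw [hc, hc', Sum.inr.injEq, Prod.ext_iff]
  omega

lemma end_unique (hne : x ≠ y) (hne' : x ≠ y') (h : IsMiddle z x.1 y.1)
    (h' : IsMiddle z x.1 y'.1) : y = y' := by
  rw [← hW.coord_inj, ((hW.isMiddle_iff hne).1 h).2.2, ((hW.isMiddle_iff hne').1 h').2.2]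

lemma start_eq_or (hne : x ≠ y) (h : IsMiddle z x.1 y.1) (h' : IsMiddle z x'.1 w) :
    x' = x ∨ x' = y := by
  by_cases hxx : x = x'
  · exact Or.inl hxx.symm
  · exact Or.inr (hW.end_unique hxx hne ⟨h.1, h.2.1, h'.2.1.symm⟩ h)

end IsClass
end VertexClasses

/-! ### The forests of a dimer covering -/

section MatchedGraph
variable {m n : ℕ} {ε : ℤ} {M : Set (Sym2 (rectSet m n))} {W : Set (rectSet m n)} {f : W → W}

/-- The graph on `W` formed by the edges with a middle vertex that is matched to an end: the forests
`F₁` and `F₂` that belong to `M`. -/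
def matchedGraph (M : Set (Sym2 (rectSet m n))) (W : Set (rectSet m n)) : SimpleGraph W where
  Adj x y := (middleGraph W).Adj x y ∧ MatchedMiddle M x.1 y.1
  symm := ⟨by
    rintro x y ⟨h, z, hz, hM⟩
    exact ⟨h.symm, z, hz.symm, hM.symm.imp (Sym2.eq_swap ▸ ·) (Sym2.eq_swap ▸ ·)⟩⟩
  loopless := ⟨fun _ h => h.1.ne rfl⟩

/-- `M` matches each vertex `x ∈ W` that `f` moves with a middle vertex of `x` and `f x`, and
matches no other vertex in `W` with a face centre. -/
structure MatchesTowards (M : Set (Sym2 (rectSet m n))) (f : W → W) : Prop where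
  adj : ∀ x, f x ≠ x → (middleGraph W).Adj x (f x)
  mem_iff : ∀ (x : W), ∀ z ∈ V₃ m n, s(x.1, z) ∈ M ↔ f x ≠ x ∧ IsMiddle z x.1 (f x).1

lemma MatchesTowards.matchedGraph_adj_iff (hf : MatchesTowards M f) (hW : IsClass ε W) (x y : W) :
    (matchedGraph M W).Adj x y ↔ x ≠ y ∧ (f x = y ∨ f y = x) := by
  have apply_eq : ∀ x y : W, x ≠ y → ∀ z, IsMiddle z x.1 y.1 → s(x.1, z) ∈ M → f x = y := by
    intro x y hne z hz hM
    obtain ⟨hx, hmid⟩ := (hf.mem_iff x z hz.1).1 hM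
    exact hW.end_unique hx.symm hne hmid hz
  have adj_apply : ∀ x : W, f x ≠ x → (matchedGraph M W).Adj x (f x) := by
    intro x hx
    obtain ⟨hne, z, hz⟩ := hf.adj x hx
    exact ⟨⟨hne, z, hz⟩, z, hz, Or.inl ((hf.mem_iff x z hz.1).2 ⟨hx, hz⟩)⟩
  constructor
  · rintro ⟨⟨hne, -⟩, z, hz, hM | hM⟩
    · exact ⟨hne, Or.inl (apply_eq x y hne z hz hM)⟩
    · exact ⟨hne, Or.inr (apply_eq y x hne.symm z hz.symm (Sym2.eq_swap ▸ hM))⟩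
  · rintro ⟨hne, rfl | rfl⟩
    exacts [adj_apply x hne.symm, (adj_apply y hne).symm]

end MatchedGraph

namespace DimerCovering
variable {m n : ℕ} {ε : ℤ} {W : Set (rectSet m n)} (M : DimerCovering (rect m n))

/-- The map `next` on the vertices of one class: the parent map of the matched forest. -/
noncomputable def parent (hW : IsClass ε W) (x : W) : W :=
  ⟨⟨Sum.inl (M.next (coord x.1)), mapsTo_next (hW.coe_eq x ▸ x.1.2 :)⟩,
    (hW _).2 ⟨_, rfl, inClass_next.2 (hW.inClass_coord x)⟩⟩

section Parent
variable (hW : IsClass ε W) (x : W)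
include hW

lemma coord_parent : coord (M.parent hW x).1 = M.next (coord x.1) := rfl

lemma coord_iterate_parent (k : ℕ) :
    coord ((M.parent hW)^[k] x).1 = M.next^[k] (coord x.1) :=
  Function.Semiconj.iterate_right (f := fun x : W => coord x.1) (fun _ => rfl) k x

lemma partner_coord : M.partner (Sum.inl (coord x.1)) = (M.mate x.1).1 := by
  rw [← hW.coe_eq, partner_coe]

lemma parent_eq_self_iff : M.parent hW x = x ↔ M.mate x.1 ∉ V₃ m n := by
  rw [← hW.coord_inj, coord_parent, next_eq_self_iff, M.partner_coord hW, notMem_V₃_iff]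

lemma isMiddle_mate_parent (hx : M.parent hW x ≠ x) :
    IsMiddle (M.mate x.1) x.1 (M.parent hW x).1 := by
  have hz : M.mate x.1 ∈ V₃ m n := by rwa [Ne, parent_eq_self_iff, not_not] at hx
  obtain ⟨c, hc⟩ := mem_V₃_iff.1 hz
  have hpartner := (M.partner_coord hW x).trans hc
  have hcoord : coord (M.mate x.1) = c := by rw [coord, hc, Sum.elim_inr, id]
  rw [hW.isMiddle_iff hx.symm, coord_parent, hcoord]
  exact ⟨hz, M.corner_of_partner_eq hpartner, next_of_inr hpartner⟩

lemma matchesTowards_parent : MatchesTowards M.1 (M.parent hW) where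
  adj x hx := ⟨hx.symm, _, M.isMiddle_mate_parent hW x hx⟩
  mem_iff := by
    intro x z hz
    rw [M.mem_iff]
    constructor
    · rintro rfl
      have hx : M.parent hW x ≠ x := fun h => (M.parent_eq_self_iff hW x).1 h hz
      exact ⟨hx, M.isMiddle_mate_parent hW x hx⟩
    · rintro ⟨hx, hmid⟩
      exact hW.middle_unique hx.symm hmid (M.isMiddle_mate_parent hW x hx)

lemma isParentMap_parent : IsParentMap (matchedGraph M.1 W) (M.parent hW) where
  adj_iff := (M.matchesTowards_parent hW).matchedGraph_adj_iff hW
  terminates := by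
    intro x
    obtain ⟨k, hk⟩ := next_terminates (M := M) (hW.coe_eq x ▸ x.1.2 :)
    exact ⟨k, hW.coord_inj.1 (by rw [coord_parent, coord_iterate_parent, hk])⟩

/-- The points of `W` that are matched with a lattice point: the roots of the matched forest. -/
def roots (W : Set (rectSet m n)) : Set (rectSet m n) := {v | v ∈ W ∧ M.mate v ∉ V₃ m n}

/-- The correspondence between the roots and the components of the matched forest. -/
noncomputable def rootEquiv : M.roots W ≃ (matchedGraph M.1 W).ConnectedComponent :=
  Equiv.trans
    { toFun := fun v => ⟨⟨v.1, v.2.1⟩, (M.parent_eq_self_iff hW _).2 v.2.2⟩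
      invFun := fun x => ⟨x.1.1, x.1.2, (M.parent_eq_self_iff hW _).1 x.2⟩
      left_inv := fun _ => rfl
      right_inv := fun _ => rfl }
    (M.isParentMap_parent hW).rootEquiv

lemma isSpanningForest_matchedGraph :
    IsSpanningForest (middleGraph W) (matchedGraph M.1 W) (M.roots W).ncard :=
  ⟨fun _ _ h => h.1, (M.isParentMap_parent hW).isAcyclic, (Nat.card_congr (M.rootEquiv hW)).symm⟩

lemma mate_mem_of_isMiddle {x y : W} {z : rectSet m n} (hadj : (matchedGraph M.1 W).Adj x y)
    (hz : IsMiddle z x.1 y.1) : M.mate z ∈ W := by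
  obtain ⟨⟨hne, -⟩, z', hz', hM⟩ := hadj
  obtain rfl := hW.middle_unique hne hz hz'
  rcases hM with hM | hM
  · rw [Sym2.eq_swap, M.mem_iff] at hM
    exact hM ▸ x.2
  · rw [M.mem_iff] at hM
    exact hM ▸ y.2

end Parent

lemma noIntersection : NoIntersection (matchedGraph M.1 (V₁ m n)) (matchedGraph M.1 (V₂ m n)) :=
  fun _ _ _ _ _ hx hy hz hz' => disjoint_V₁_V₂.le_bot
    ⟨M.mate_mem_of_isMiddle isClass_V₁ hx hz, M.mate_mem_of_isMiddle isClass_V₂ hy hz'⟩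

/-! ### Impurities -/

/-- The matching of the roots in `V₁` with the roots in `V₂`. -/
noncomputable def mateRoots : M.roots (V₁ m n) ≃ M.roots (V₂ m n) where
  toFun v := ⟨M.mate v, (mem_V₁_iff_mem_V₂_of_adj (M.adj_mate v) (isClass_V₁.notMem_V₃ v.2.1)
    v.2.2).1 v.2.1, (M.mate_mate v).symm ▸ isClass_V₁.notMem_V₃ v.2.1⟩
  invFun v := ⟨M.mate v, (mem_V₁_iff_mem_V₂_of_adj (M.adj_mate v).symm v.2.2
    (isClass_V₂.notMem_V₃ v.2.1)).2 v.2.1, (M.mate_mate v).symm ▸ isClass_V₂.notMem_V₃ v.2.1⟩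
  left_inv v := Subtype.ext (M.mate_mate v)
  right_inv v := Subtype.ext (M.mate_mate v)

lemma ncard_roots_V₂ : (M.roots (V₂ m n)).ncard = (M.roots (V₁ m n)).ncard :=
  (Nat.card_congr M.mateRoots).symm

lemma roots_union_image_mate_V₃ :
    (M.roots (V₁ m n) ∪ M.roots (V₂ m n)) ∪ M.mate '' V₃ m n = (V₃ m n)ᶜ := by
  ext v
  have hV : v ∈ (V₃ m n)ᶜ ↔ v ∈ V₁ m n ∨ v ∈ V₂ m n := by rw [compl_V₃, Set.mem_union]
  constructor
  · rintro ((h | h) | ⟨z, hz, rfl⟩)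
    exacts [hV.2 (Or.inl h.1), hV.2 (Or.inr h.1), notMem_V₃_of_adj (M.adj_mate z) hz]
  · intro hv
    by_cases h : M.mate v ∈ V₃ m n
    · exact Or.inr ⟨_, h, M.mate_mate v⟩
    · exact Or.inl ((hV.1 hv).imp (⟨·, h⟩) (⟨·, h⟩))

lemma ncard_roots_V₁ : (M.roots (V₁ m n)).ncard = (m + n + 1) / 2 := by
  have disjoint_roots : Disjoint (M.roots (V₁ m n)) (M.roots (V₂ m n)) :=
    disjoint_V₁_V₂.mono (fun _ h => h.1) fun _ h => h.1
  have disjoint_image : Disjoint (M.roots (V₁ m n) ∪ M.roots (V₂ m n)) (M.mate '' V₃ m n) := by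
    rw [Set.disjoint_right]
    rintro _ ⟨z, hz, rfl⟩ (h | h) <;> exact h.2 ((M.mate_mate z).symm ▸ hz)
  have hcard := congrArg Set.ncard M.roots_union_image_mate_V₃
  rw [Set.ncard_union_eq disjoint_image, Set.ncard_union_eq disjoint_roots, ncard_roots_V₂,
    Set.ncard_image_of_injective _ (Function.LeftInverse.injective M.mate_mate), ncard_V₃,
    ncard_compl_V₃] at hcard
  have : (m + 1) * (n + 1) = m * n + (m + n + 1) := by ring
  omega

lemma mk_mate_mem_E₂ {v : rectSet m n} (hv : v ∉ V₃ m n) (hmate : M.mate v ∉ V₃ m n) :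
    s(v, M.mate v) ∈ E₂ m n := by
  refine ⟨M.adj_mate v, fun u hu => compl_V₃.subset ?_⟩
  rcases Sym2.mem_iff.1 hu with rfl | rfl
  exacts [hv, hmate]

lemma inter_E₂ : M.1 ∩ E₂ m n = (fun v => s(v, M.mate v)) '' M.roots (V₁ m n) := by
  ext e
  constructor
  · induction e using Sym2.ind with
    | _ v w =>
      rintro ⟨hM, -, hmem⟩
      obtain rfl := M.mem_iff.1 hM
      have hmate : M.mate v ∉ V₃ m n := compl_V₃.superset (hmem _ (Sym2.mem_mk_right _ _))
      rcases hmem v (Sym2.mem_mk_left _ _) with h | h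
      · exact ⟨v, ⟨h, hmate⟩, rfl⟩
      · refine ⟨M.mate v, (M.mateRoots.symm ⟨v, h, hmate⟩).2, ?_⟩
        simp only [mate_mate, Sym2.eq_swap]
  · rintro ⟨v, hv, rfl⟩
    exact ⟨M.mk_mate_mem v, M.mk_mate_mem_E₂ (isClass_V₁.notMem_V₃ hv.1) hv.2⟩

lemma ncard_inter_E₂ : (M.1 ∩ E₂ m n).ncard = (m + n + 1) / 2 := by
  rw [inter_E₂, Set.InjOn.ncard_image, ncard_roots_V₁]
  intro v hv w hw h
  rcases Sym2.eq_iff.1 h with ⟨h, -⟩ | ⟨rfl, -⟩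
  · exact h
  · exact absurd hv.1 (disjoint_V₁_V₂.notMem_of_mem_right (M.mateRoots ⟨w, hw⟩).2.1)

lemma pairs :
    Pairs (M.1 ∩ E₂ m n) (matchedGraph M.1 (V₁ m n)) (matchedGraph M.1 (V₂ m n)) := by
  let ρ₁ := M.rootEquiv isClass_V₁
  let ρ₂ := M.rootEquiv isClass_V₂
  let σ := ρ₁.symm.trans (M.mateRoots.trans ρ₂)
  have joins : ∀ v : M.roots (V₁ m n), Joins s(v.1, M.mate v) (ρ₁ v) (σ (ρ₁ v)) := fun v =>
    ⟨⟨v, v.2.1⟩, ⟨_, (M.mateRoots v).2.1⟩, rfl, rfl,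
      congrArg (ρ₂ <| M.mateRoots ·) (ρ₁.symm_apply_apply v).symm⟩
  refine ⟨σ, fun c => ?_, ?_⟩
  · obtain ⟨v, rfl⟩ := ρ₁.surjective c
    refine ⟨s(v.1, M.mate v), ⟨M.inter_E₂ ▸ ⟨v, v.2, rfl⟩, joins v⟩, ?_⟩
    rintro e ⟨⟨hM, -⟩, x, y, rfl, hx, -⟩
    have hy : y.1 = M.mate x.1 := M.mem_iff.1 hM
    have hroot : x.1 ∈ M.roots (V₁ m n) := ⟨x.2, hy ▸ isClass_V₂.notMem_V₃ y.2⟩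
    obtain rfl : ⟨x.1, hroot⟩ = v := ρ₁.injective hx
    rw [hy]
  · rw [inter_E₂]
    rintro _ ⟨v, hv, rfl⟩
    exact ⟨_, joins ⟨v, hv⟩⟩

/-- The triple of forests and impurities that belongs to a dimer covering. -/
def toPairedForests : PairedForests m n ((m + n + 1) / 2) where
  F₁ := matchedGraph M.1 (V₁ m n)
  F₂ := matchedGraph M.1 (V₂ m n)
  impurities := M.1 ∩ E₂ m n
  forest₁ := M.ncard_roots_V₁ ▸ M.isSpanningForest_matchedGraph isClass_V₁
  forest₂ := M.ncard_roots_V₁ ▸ M.ncard_roots_V₂ ▸ M.isSpanningForest_matchedGraph isClass_V₂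
  impurities_subset := Set.inter_subset_right
  impurities_ncard := M.ncard_inter_E₂
  noIntersection := M.noIntersection
  pairs := M.pairs

/-! ### Injectivity -/

variable {M} {M' : DimerCovering (rect m n)} {v : rectSet m n}

lemma mate_eq_of_mate_notMem_V₃ (hI : M.1 ∩ E₂ m n = M'.1 ∩ E₂ m n) (hv : v ∉ V₃ m n)
    (hmate : M.mate v ∉ V₃ m n) : M.mate v = M'.mate v := by
  have hmem : s(v, M.mate v) ∈ M.1 ∩ E₂ m n := ⟨M.mk_mate_mem v, M.mk_mate_mem_E₂ hv hmate⟩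
  rw [hI] at hmem
  exact M'.mem_iff.1 hmem.1

lemma mate_eq_of_mem_isClass (hI : M.1 ∩ E₂ m n = M'.1 ∩ E₂ m n) (hW : IsClass ε W)
    (hF : matchedGraph M.1 W = matchedGraph M'.1 W) (hv : v ∈ W) : M.mate v = M'.mate v := by
  have hv₃ : ∀ {v}, v ∈ W → v ∉ V₃ m n := hW.notMem_V₃
  have hparent : M.parent hW = M'.parent hW := by
    refine (M.isParentMap_parent hW).eq_of_fixedPoints_eq (hF ▸ M'.isParentMap_parent hW) ?_
    ext x
    rw [Function.mem_fixedPoints_iff, Function.mem_fixedPoints_iff, parent_eq_self_iff,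
      parent_eq_self_iff]
    exact ⟨fun h => mate_eq_of_mate_notMem_V₃ hI (hv₃ x.2) h ▸ h,
      fun h => mate_eq_of_mate_notMem_V₃ hI.symm (hv₃ x.2) h ▸ h⟩
  by_cases hmate : M.mate v ∈ V₃ m n
  · rw [← M'.mem_iff, (M'.matchesTowards_parent hW).mem_iff ⟨v, hv⟩ _ hmate, ← hparent,
      ← (M.matchesTowards_parent hW).mem_iff ⟨v, hv⟩ _ hmate]
    exact M.mk_mate_mem v
  · exact mate_eq_of_mate_notMem_V₃ hI (hv₃ hv) hmate

theorem toPairedForests_injective :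
    Function.Injective (toPairedForests : DimerCovering (rect m n) → _) := by
  intro M M' h
  have hI : M.1 ∩ E₂ m n = M'.1 ∩ E₂ m n := congrArg PairedForests.impurities h
  have mate_eq : ∀ v, v ∉ V₃ m n → M.mate v = M'.mate v := by
    intro v hv
    rcases compl_V₃.subset hv with hv | hv
    exacts [mate_eq_of_mem_isClass hI isClass_V₁ (congrArg PairedForests.F₁ h) hv,
      mate_eq_of_mem_isClass hI isClass_V₂ (congrArg PairedForests.F₂ h) hv]
  refine ext_mate fun v => ?_
  by_cases hv : v ∈ V₃ m n
  · have := mate_eq (M.mate v) (notMem_V₃_of_adj (M.adj_mate v) hv)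
    rw [mate_mate] at this
    nth_rw 2 [this]
    rw [mate_mate]
  · exact mate_eq v hv

end DimerCovering

/-! ### Surjectivity -/

section PerfectMatching
variable {V : Type*} {S T : Set (Sym2 V)}

lemma existsUnique_mem_of_pairwiseDisjoint [Finite V] (hdiag : ∀ e ∈ S, ¬ e.IsDiag)
    (hS : S.PairwiseDisjoint ((↑) : Sym2 V → Set V)) (hcard : 2 * S.ncard = Nat.card V) (v : V) :
    ∃! e, e ∈ S ∧ v ∈ e := by
  classical
  have := Fintype.ofFinite V
  have hfin : S.Finite := S.toFinite
  have hdisj : (hfin.toFinset : Set (Sym2 V)).PairwiseDisjoint Sym2.toFinset := by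
    intro e he e' he' hne
    rw [hfin.coe_toFinset] at he he'
    have := hS he he' hne
    rw [Function.onFun, Set.disjoint_left] at this
    rw [Function.onFun, Finset.disjoint_left]
    exact fun u hu hu' => this (Sym2.mem_toFinset.1 hu) (Sym2.mem_toFinset.1 hu')
  have hcover : hfin.toFinset.biUnion Sym2.toFinset = Finset.univ := by
    rw [← Finset.card_eq_iff_eq_univ, Finset.card_biUnion hdisj, Finset.sum_const_nat fun e he =>
      Sym2.card_toFinset_of_not_isDiag e (hdiag e (hfin.mem_toFinset.1 he)),
      ← Set.ncard_eq_toFinset_card S hfin, mul_comm, hcard, Nat.card_eq_fintype_card]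
  obtain ⟨e, he, hv⟩ := Finset.mem_biUnion.1 (hcover ▸ Finset.mem_univ v)
  refine ⟨e, ⟨hfin.mem_toFinset.1 he, Sym2.mem_toFinset.1 hv⟩, fun e' ⟨he', hv'⟩ => ?_⟩
  exact hS.elim_set he' (hfin.mem_toFinset.1 he) v hv' (Sym2.mem_toFinset.1 hv)

lemma disjoint_of_forall_disjoint (h : ∀ e ∈ S, ∀ e' ∈ T, Disjoint (e : Set V) e') :
    Disjoint S T := by
  rw [Set.disjoint_left]
  intro e he he'
  induction e using Sym2.ind with
  | _ v w => exact Set.disjoint_left.1 (h _ he _ he') (Sym2.mem_mk_left v w) (Sym2.mem_mk_left v w)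

end PerfectMatching

section Steps
variable {m n : ℕ} {ε : ℤ} {W : Set (rectSet m n)} {F : SimpleGraph W} {f : W → W}
  {e : Sym2 (rectSet m n)} {v z : rectSet m n}

/-- The edges that join the vertices moved by `f` with the face centre crossed on the way. -/
def steps (f : W → W) : Set (Sym2 (rectSet m n)) :=
  {e | ∃ (x : W) (z : _), f x ≠ x ∧ IsMiddle z x.1 (f x).1 ∧ e = s(x.1, z)}

lemma steps_subset_edgeSet : steps f ⊆ (rect m n).edgeSet := by
  rintro _ ⟨x, z, -, hz, rfl⟩
  exact hz.2.1

lemma exists_of_mem_steps (he : e ∈ steps f) (hv : v ∈ e) (hv₃ : v ∉ V₃ m n) :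
    ∃ x : W, f x ≠ x ∧ x.1 = v := by
  obtain ⟨x, z, hx, hz, rfl⟩ := he
  rcases Sym2.mem_iff.1 hv with rfl | rfl
  exacts [⟨x, hx, rfl⟩, absurd hz.1 hv₃]

lemma exists_isMiddle_of_mem_steps (hW : IsClass ε W) (he : e ∈ steps f) (hz : z ∈ e)
    (hz₃ : z ∈ V₃ m n) : ∃ x : W, f x ≠ x ∧ IsMiddle z x.1 (f x).1 ∧ e = s(x.1, z) := by
  obtain ⟨x, z', hx, hz', rfl⟩ := he
  rcases Sym2.mem_iff.1 hz with rfl | rfl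
  exacts [absurd hz₃ (hW.notMem_V₃ x.2), ⟨x, hx, hz', rfl⟩]

lemma mk_mem_steps_iff (hW : IsClass ε W) {x : W} (hz : z ∈ V₃ m n) :
    s(x.1, z) ∈ steps f ↔ f x ≠ x ∧ IsMiddle z x.1 (f x).1 := by
  refine ⟨fun h => ?_, fun ⟨hx, hmid⟩ => ⟨x, z, hx, hmid, rfl⟩⟩
  obtain ⟨y, hy, hmid, hxy⟩ := exists_isMiddle_of_mem_steps hW h (Sym2.mem_mk_right _ _) hz
  obtain rfl : x = y := Subtype.ext (Sym2.congr_left.1 hxy)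
  exact ⟨hy, hmid⟩

lemma IsParentMap.eq_of_isMiddle (hf : IsParentMap F f) (hW : IsClass ε W) {x y : W}
    (hx : f x ≠ x) (hy : f y ≠ y) (hzx : IsMiddle z x.1 (f x).1) (hzy : IsMiddle z y.1 (f y).1) :
    x = y := by
  by_contra hne
  have hxy : f x = y := ((hW.start_eq_or hx.symm hzx hzy).resolve_left (Ne.symm hne)).symm
  have hyx : f y = x := ((hW.start_eq_or hy.symm hzy hzx).resolve_left hne).symm
  exact hf.iterate_ne hx 1 (by rw [Function.iterate_succ_apply, Function.iterate_one, hxy, hyx])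

lemma pairwiseDisjoint_steps (hf : IsParentMap F f) (hW : IsClass ε W) :
    (steps f).PairwiseDisjoint ((↑) : Sym2 (rectSet m n) → Set (rectSet m n)) := by
  rintro _ ⟨x, z, hx, hz, rfl⟩ e' he' hne
  refine Set.disjoint_left.2 fun v hv hv' => hne ?_
  rcases Sym2.mem_iff.1 hv with rfl | rfl
  · obtain ⟨y, z', hy, hz', rfl⟩ := he'
    rcases Sym2.mem_iff.1 hv' with hxy | hxz'
    · obtain rfl : x = y := Subtype.ext hxy
      rw [hW.middle_unique hx.symm hz hz']
    · exact absurd (hxz' ▸ hz'.1) (hW.notMem_V₃ x.2)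
  · obtain ⟨y, hy, hz', rfl⟩ := exists_isMiddle_of_mem_steps hW he' hv' hz.1
    rw [hf.eq_of_isMiddle hW hx hy hz hz']

lemma ncard_steps (hf : IsParentMap F f) (hW : IsClass ε W) (hF : F ≤ middleGraph W) :
    (steps f).ncard + Nat.card F.ConnectedComponent = W.ncard := by
  have exists_middle : ∀ x : W, ∃ z, f x ≠ x → IsMiddle z x.1 (f x).1 := by
    intro x
    by_cases hx : f x = x
    · exact ⟨x, fun h => absurd hx h⟩
    · obtain ⟨-, z, hz⟩ := hF (hf.adj hx)
      exact ⟨z, fun _ => hz⟩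
  choose z hz using exists_middle
  have himage : steps f = (fun x : W => s(x.1, z x)) '' {x | f x ≠ x} := by
    ext e
    constructor
    · rintro ⟨x, z', hx, hz', rfl⟩
      exact ⟨x, hx, congrArg (s(x.1, ·)) (hW.middle_unique hx.symm (hz x hx) hz')⟩
    · rintro ⟨x, hx, rfl⟩
      exact ⟨x, z x, hx, hz x hx, rfl⟩
  have hinj : Set.InjOn (fun x : W => s(x.1, z x)) {x | f x ≠ x} := by
    intro x _ y hy hxy
    rcases Sym2.eq_iff.1 hxy with ⟨h, -⟩ | ⟨h, -⟩
    · exact Subtype.ext h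
    · exact absurd (h ▸ (hz y hy).1) (hW.notMem_V₃ x.2)
  have hcompl : {x | f x ≠ x}ᶜ = Function.fixedPoints f := by
    ext x
    exact not_not
  rw [himage, hinj.ncard_image, ← Nat.card_congr hf.rootEquiv, Nat.card_coe_set_eq, ← hcompl,
    Set.ncard_add_ncard_compl, Nat.card_coe_set_eq]

end Steps

namespace PairedForests
variable {m n k : ℕ} {T : PairedForests m n k} {f : V₁ m n → V₁ m n} {g : V₂ m n → V₂ m n}
  {e : Sym2 (rectSet m n)} {v : rectSet m n}

/-- `f` and `g` are the parent maps of the two forests of `T` when each tree is rooted at the end of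
its impurity. -/
structure IsOriented (T : PairedForests m n k) (f : V₁ m n → V₁ m n) (g : V₂ m n → V₂ m n) :
    Prop where
  isParentMap₁ : IsParentMap T.F₁ f
  isParentMap₂ : IsParentMap T.F₂ g
  impurities_eq : ∃ τ : Function.fixedPoints f ≃ Function.fixedPoints g,
    T.impurities = Set.range fun x => s(x.1.1, (τ x).1.1)

lemma exists_roots (T : PairedForests m n k) : ∃ (ρ₁ : T.F₁.ConnectedComponent → V₁ m n)
    (ρ₂ : T.F₂.ConnectedComponent → V₂ m n) (σ : T.F₁.ConnectedComponent ≃ T.F₂.ConnectedComponent),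
    (∀ c, T.F₁.connectedComponentMk (ρ₁ c) = c) ∧ (∀ c, T.F₂.connectedComponentMk (ρ₂ c) = c) ∧
    T.impurities = Set.range fun c => s((ρ₁ c).1, (ρ₂ (σ c)).1) := by
  obtain ⟨σ, hσ, hjoins⟩ := T.pairs
  choose e he he_unique using hσ
  choose x y hxy hx hy using fun c => (he c).2
  refine ⟨x, y ∘ σ.symm, σ, hx, fun c => ?_, ?_⟩
  · rw [Function.comp_apply, hy, σ.apply_symm_apply]
  · simp only [Function.comp_apply, σ.symm_apply_apply, ← hxy]
    ext e'
    constructor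
    · intro h
      obtain ⟨c, hc⟩ := hjoins e' h
      exact ⟨c, (he_unique c e' ⟨h, hc⟩).symm⟩
    · rintro ⟨c, rfl⟩
      exact (he c).1

lemma exists_isOriented (T : PairedForests m n k) : ∃ f g, T.IsOriented f g := by
  obtain ⟨ρ₁, ρ₂, σ, hρ₁, hρ₂, himp⟩ := T.exists_roots
  obtain ⟨f, hf, hfix₁⟩ := exists_isParentMap T.forest₁.2.1 ρ₁ hρ₁
  obtain ⟨g, hg, hfix₂⟩ := exists_isParentMap T.forest₂.2.1 ρ₂ hρ₂
  have symm₁ : ∀ c, (hf.rootEquiv.symm c).1 = ρ₁ c := fun c =>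
    hf.coe_rootEquiv_symm_eq (hfix₁.superset ⟨c, rfl⟩) (hρ₁ c)
  have symm₂ : ∀ c, (hg.rootEquiv.symm c).1 = ρ₂ c := fun c =>
    hg.coe_rootEquiv_symm_eq (hfix₂.superset ⟨c, rfl⟩) (hρ₂ c)
  refine ⟨f, g, hf, hg, hf.rootEquiv.trans (σ.trans hg.rootEquiv.symm), ?_⟩
  rw [himp, ← hf.rootEquiv.symm.surjective.range_comp]
  refine congrArg Set.range (funext fun c => ?_)
  simp only [Function.comp_apply, Equiv.trans_apply, Equiv.apply_symm_apply, symm₁, symm₂]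

lemma notMem_V₃_of_mem_impurities (he : e ∈ T.impurities) (hv : v ∈ e) : v ∉ V₃ m n :=
  compl_V₃.superset ((T.impurities_subset he).2 v hv)

/-- The dimers of the covering that belongs to `T`, if `f` and `g` are the parent maps of the two
forests: the impurities, and an edge from each vertex that is not a root towards its parent. -/
def dimers (T : PairedForests m n k) (f : V₁ m n → V₁ m n) (g : V₂ m n → V₂ m n) :
    Set (Sym2 (rectSet m n)) :=
  T.impurities ∪ (steps f ∪ steps g)

lemma dimers_inter_E₂ (T : PairedForests m n k) : T.dimers f g ∩ E₂ m n = T.impurities := by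
  refine Set.Subset.antisymm ?_ fun e he => ⟨Or.inl he, T.impurities_subset he⟩
  rintro e ⟨he | ⟨x, z, -, hz, rfl⟩ | ⟨x, z, -, hz, rfl⟩, -, hmem⟩
  · exact he
  all_goals exact absurd hz.1 (compl_V₃.superset (hmem z (Sym2.mem_mk_right _ _)))

lemma dimers_subset_edgeSet (T : PairedForests m n k) : T.dimers f g ⊆ (rect m n).edgeSet :=
  Set.union_subset (fun _ he => (T.impurities_subset he).1)
    (Set.union_subset steps_subset_edgeSet steps_subset_edgeSet)

namespace IsOriented
variable (h : T.IsOriented f g)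
include h

lemma pairwiseDisjoint_impurities :
    T.impurities.PairwiseDisjoint ((↑) : Sym2 (rectSet m n) → Set (rectSet m n)) := by
  obtain ⟨τ, hτ⟩ := h.impurities_eq
  have ne : ∀ (x : V₁ m n) (y : V₂ m n), x.1 ≠ y.1 := fun x y =>
    disjoint_V₁_V₂.ne_of_mem x.2 y.2
  rw [hτ]
  rintro _ ⟨x, rfl⟩ _ ⟨y, rfl⟩ hne
  refine Set.disjoint_left.2 fun v hv hv' => hne ?_
  rcases Sym2.mem_iff.1 hv with rfl | rfl <;> rcases Sym2.mem_iff.1 hv' with hxy | hxy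
  · rw [Subtype.ext (Subtype.ext hxy)]
  · exact absurd hxy (ne _ _)
  · exact absurd hxy.symm (ne _ _)
  · rw [τ.injective (Subtype.ext (Subtype.ext hxy))]

lemma disjoint_impurities_steps (he : e ∈ T.impurities) {e' : Sym2 (rectSet m n)}
    (he' : e' ∈ steps f ∪ steps g) :
    Disjoint (e : Set (rectSet m n)) e' := by
  obtain ⟨τ, hτ⟩ := h.impurities_eq
  refine Set.disjoint_left.2 fun v hv hv' => ?_
  have hv₃ := notMem_V₃_of_mem_impurities he hv
  rw [hτ] at he
  obtain ⟨x, rfl⟩ := he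
  rcases he' with he' | he' <;> obtain ⟨y, hy, rfl⟩ := exists_of_mem_steps he' hv' hv₃ <;>
    rcases Sym2.mem_iff.1 hv with hyx | hyx
  · exact hy (Subtype.ext hyx ▸ x.2)
  · exact disjoint_V₁_V₂.ne_of_mem y.2 (τ x).1.2 hyx
  · exact disjoint_V₁_V₂.ne_of_mem x.1.2 y.2 hyx.symm
  · exact hy (Subtype.ext hyx ▸ (τ x).2)

lemma disjoint_steps (he : e ∈ steps f) {e' : Sym2 (rectSet m n)} (he' : e' ∈ steps g) :
    Disjoint (e : Set (rectSet m n)) e' := by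
  refine Set.disjoint_left.2 fun v hv hv' => ?_
  by_cases hv₃ : v ∈ V₃ m n
  · obtain ⟨x, hx, hvx, -⟩ := exists_isMiddle_of_mem_steps isClass_V₁ he hv hv₃
    obtain ⟨y, hy, hvy, -⟩ := exists_isMiddle_of_mem_steps isClass_V₂ he' hv' hv₃
    exact T.noIntersection _ _ _ _ v (h.isParentMap₁.adj hx) (h.isParentMap₂.adj hy) hvx hvy
  · obtain ⟨x, -, rfl⟩ := exists_of_mem_steps he hv hv₃
    obtain ⟨y, -, hyx⟩ := exists_of_mem_steps he' hv' hv₃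
    exact disjoint_V₁_V₂.ne_of_mem x.2 y.2 hyx.symm

lemma pairwiseDisjoint_dimers : (T.dimers f g).PairwiseDisjoint
    ((↑) : Sym2 (rectSet m n) → Set (rectSet m n)) := by
  rw [dimers, Set.pairwiseDisjoint_union, Set.pairwiseDisjoint_union]
  exact ⟨h.pairwiseDisjoint_impurities, ⟨pairwiseDisjoint_steps h.isParentMap₁ isClass_V₁,
    pairwiseDisjoint_steps h.isParentMap₂ isClass_V₂, fun _ he _ he' _ => h.disjoint_steps he he'⟩,
    fun _ he _ he' _ => h.disjoint_impurities_steps he he'⟩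

lemma ncard_dimers : (T.dimers f g).ncard + k = (m + 1) * (n + 1) := by
  have hsteps₁ := ncard_steps h.isParentMap₁ isClass_V₁ T.forest₁.1
  have hsteps₂ := ncard_steps h.isParentMap₂ isClass_V₂ T.forest₂.1
  rw [T.forest₁.2.2] at hsteps₁
  rw [T.forest₂.2.2] at hsteps₂
  rw [dimers,
    Set.ncard_union_eq (disjoint_of_forall_disjoint fun _ he _ => h.disjoint_impurities_steps he),
    Set.ncard_union_eq (disjoint_of_forall_disjoint fun _ he _ => h.disjoint_steps he),
    T.impurities_ncard, ← ncard_compl_V₃, compl_V₃, Set.ncard_union_eq disjoint_V₁_V₂]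
  omega

lemma matchesTowards₁ : MatchesTowards (T.dimers f g) f where
  adj x hx := T.forest₁.1 (h.isParentMap₁.adj hx)
  mem_iff x z hz := by
    have himp : s(x.1, z) ∉ T.impurities := fun he =>
      notMem_V₃_of_mem_impurities he (Sym2.mem_mk_right _ _) hz
    have hsteps : s(x.1, z) ∉ steps g := by
      intro he
      obtain ⟨y, -, hyx⟩ :=
        exists_of_mem_steps he (Sym2.mem_mk_left _ _) (isClass_V₁.notMem_V₃ x.2)
      exact disjoint_V₁_V₂.ne_of_mem x.2 y.2 hyx.symm
    rw [dimers, Set.mem_union, or_iff_right himp, Set.mem_union, or_iff_left hsteps,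
      mk_mem_steps_iff isClass_V₁ hz]

lemma matchesTowards₂ : MatchesTowards (T.dimers f g) g where
  adj x hx := T.forest₂.1 (h.isParentMap₂.adj hx)
  mem_iff x z hz := by
    have himp : s(x.1, z) ∉ T.impurities := fun he =>
      notMem_V₃_of_mem_impurities he (Sym2.mem_mk_right _ _) hz
    have hsteps : s(x.1, z) ∉ steps f := by
      intro he
      obtain ⟨y, -, hyx⟩ :=
        exists_of_mem_steps he (Sym2.mem_mk_left _ _) (isClass_V₂.notMem_V₃ x.2)
      exact disjoint_V₁_V₂.ne_of_mem y.2 x.2 hyx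
    rw [dimers, Set.mem_union, or_iff_right himp, Set.mem_union, or_iff_right hsteps,
      mk_mem_steps_iff isClass_V₂ hz]

end IsOriented

theorem exists_toPairedForests (hmn : Odd (m + n)) (T : PairedForests m n ((m + n + 1) / 2)) :
    ∃ M : DimerCovering (rect m n), M.toPairedForests = T := by
  obtain ⟨f, g, h⟩ := T.exists_isOriented
  have hcard : 2 * (T.dimers f g).ncard = Nat.card (rectSet m n) := by
    rw [← Set.ncard_add_ncard_compl (V₃ m n), ncard_V₃, ncard_compl_V₃]
    have hM := h.ncard_dimers
    have : (m + 1) * (n + 1) = m * n + (m + n + 1) := by ring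
    obtain ⟨t, ht⟩ := hmn
    omega
  have hF₁ : matchedGraph (T.dimers f g) (V₁ m n) = T.F₁ := by
    ext x y
    rw [h.matchesTowards₁.matchedGraph_adj_iff isClass_V₁, h.isParentMap₁.adj_iff]
  have hF₂ : matchedGraph (T.dimers f g) (V₂ m n) = T.F₂ := by
    ext x y
    rw [h.matchesTowards₂.matchedGraph_adj_iff isClass_V₂, h.isParentMap₂.adj_iff]
  refine ⟨⟨T.dimers f g, T.dimers_subset_edgeSet, existsUnique_mem_of_pairwiseDisjoint
    (fun e he => (rect m n).not_isDiag_of_mem_edgeSet (T.dimers_subset_edgeSet he))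
    h.pairwiseDisjoint_dimers hcard⟩, ?_⟩
  have hI := T.dimers_inter_E₂ (f := f) (g := g)
  rcases T with ⟨F₁, F₂, I⟩
  exact (PairedForests.mk.injEq ..).mpr ⟨hF₁, hF₂, hI⟩

end PairedForests
end RadialGraph

open RadialGraph in
theorem theorem1 (m n : ℕ) (hmn : Odd (m + n)) :
    ∃ Φ : DimerCovering (rect m n) ≃ PairedForests m n ((m + n + 1) / 2),
      ∀ M : DimerCovering (rect m n),
        (Φ M).impurities = M.1 ∩ E₂ m n ∧
        (∀ x y : V₁ m n, (Φ M).F₁.Adj x y ↔ (G₁ m n).Adj x y ∧ MatchedMiddle M.1 x.1 y.1) ∧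
        (∀ x y : V₂ m n, (Φ M).F₂.Adj x y ↔ (G₂ m n).Adj x y ∧ MatchedMiddle M.1 x.1 y.1) := by
  refine ⟨Equiv.ofBijective DimerCovering.toPairedForests
    ⟨DimerCovering.toPairedForests_injective, PairedForests.exists_toPairedForests hmn⟩,
    fun M => ⟨rfl, fun _ _ => Iff.rfl, fun _ _ => Iff.rfl⟩⟩
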